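/- Notation. Let $\Gamma=\mathrm{SL}(2,\mathbb{Z})$, $S=\begin{pmatrix}0&-1\\1&0\end{pmatrix}$, $T=\begin{pmatrix}1&1\\0&1\end{pmatrix}$, let $\mathfrak{H}$ be the complex upper half plane, $q^{\delta}=e^{2\pi i\delta\tau}$ for $\tau\in\mathfrak{H}$, and $e(x)=e^{2\pi i x}$ for $x\in\mathbb{Q}/\mathbb{Z}$. For a representation $\rho:\Gamma\to\mathrm{GL}(n,\mathbb{C})$ and an integer $k$, let $M_k(\rho)$ be the space of holomorphic maps $F:\mathfrak{H}\to\mathbb{C}^n$ (column vectors) that satisfy $(c\tau+d)^{-k}F(A\tau)=\rho(A)F(\tau)$ for all $A=\begin{pmatrix}a&b\\c&d\end{pmatrix}\in\Gamma$ and are bounded in every region $\mathrm{Im}(\tau)\ge t$ with $t>0$. Let $M$ be a finite abelian group, $\mathcal{Q}:M\to\mathbb{Q}/\mathbb{Z}$ a non-degenerate quadratic form, and $\mathcal{B}(x,y)=\mathcal{Q}(x+y)-\mathcal{Q}(x)-\mathcal{Q}(y)$. Its Weil representation $\omega=\omega_{(M,\mathcal{Q})}$ on $\mathbb{C}^M$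 is given on generators by $$(f|\omega(T))(x)=e(\mathcal{Q}(x))f(x),\qquad (f|\omega(S))(x)=\gamma^{-1}\sum_{y\in M}e(-\mathcal{B}(x,y))f(y),\qquad \gamma=\sum_{x\in M}e(\mathcal{Q}(x)),$$ and it is called proper if these operators define a true (not only projective) right-representation of $\Gamma$, i.e. with $f|\omega(AB)=(f|\omega(A))|\omega(B)$. Here $f|\omega(A)$ is applied componentwise to vectors of functions. **Theorem (Realization by theta series).** Let $(M,\mathcal{Q})$ be as above with $\omega$ proper, let $\rho:\Gamma\to\mathrm{GL}(n,\mathbb{C})$ be a representation, and let $\Phi$ be a column vector of $n$ linearly independent functions in $\mathbb{C}^M$ such that $\Phi|\omega(A)=\rho(A)\Phi$ for all $A\in\Gamma$. Let $(L,Q)$ be a lift of $(M,\mathcal{Q})$ of rank $2r$: that is, $L$ is a complete lattice in a rational vector space $V$ of dimension $2r$, $Q$ is a positive definite quadratic form on $V$ with $Q(L)\subset\mathbb{Z}$, and, with $B(x,y)=Q(x+y)-Q(x)-Q(y)$ and $L^\sharp=\{y\in V: B(L,y)\subset\mathbb{Z}\}$, there is given a group isomorphism $\pi:L^\sharp/L\to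 M$ with $\mathcal{Q}(\pi(x+L))=Q(x)+\mathbb{Z}$ for all $x\in L^\sharp$. Write $\pi(x)$ for $\pi(x+L)$. Let $p:V\to\mathbb{C}$ be a homogeneous spherical polynomial of degree $\nu$ with respect to $Q$: in the coordinates $\xi_j$ of a basis $b_j$ of $V$, it is a complex homogeneous polynomial of degree $\nu$ with $\sum_{j,k}(G^{-1})_{jk}\frac{\partial^2 p}{\partial\xi_j\partial\xi_k}=0$, where $G=(B(b_j,b_k))_{j,k}$. Then the series $$\theta(\tau)=\sum_{x\in L^\sharp}\Phi(\pi(x))\,p(x)\,q^{Q(x)}$$ converges absolutely for every $\tau\in\mathfrak{H}$, and $\theta\in M_{r+\nu}(\rho)$. -/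

import Mathlib

open scoped MatrixGroups

noncomputable section

namespace ThetaRealization

/-! ### Weil representations -/

/-- The value group `ℚ/ℤ` of the quadratic forms on finite abelian groups. -/
abbrev QModZ : Type := AddCircle (1 : ℚ)

/-- `e(x) = exp(2πi r)` for `x ∈ ℚ/ℤ`, where `r` is any representative of `x`. -/
def e : QModZ → ℂ :=
  Quotient.lift (fun r : ℚ ↦ Complex.exp (2 * Real.pi * Complex.I * (r : ℂ))) (by
    intro a b hab
    obtain ⟨n, hn⟩ := AddSubgroup.mem_zmultiples_iff.mp (QuotientAddGroup.leftRel_apply.mp hab)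
    have hb : b = a + n := by
      rw [zsmul_one] at hn
      rw [hn]; ring
    have key : 2 * (Real.pi : ℂ) * Complex.I * ((b : ℚ) : ℂ)
        = 2 * Real.pi * Complex.I * ((a : ℚ) : ℂ) + n * (2 * Real.pi * Complex.I) := by
      rw [hb]; push_cast; ring
    change Complex.exp _ = Complex.exp _
    rw [key, Complex.exp_add, Complex.exp_int_mul_two_pi_mul_I, mul_one])

theorem e_coe (r : ℚ) : e (r : QModZ) = Complex.exp (2 * Real.pi * Complex.I * (r : ℂ)) := rfl

section Weil

variable {M : Type*} [AddCommGroup M]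

/-- Non-degeneracy of a quadratic form `𝒬 : M → ℚ/ℤ`: for each `x ≠ 0` there is `y` with
`ℬ(x, y) ≠ 0`, where `ℬ(x, y) = 𝒬(x + y) - 𝒬(x) - 𝒬(y)`. -/
def IsNondegenerate (𝒬 : QuadraticMap ℤ M QModZ) : Prop :=
  ∀ x : M, x ≠ 0 → ∃ y : M, QuadraticMap.polar 𝒬 x y ≠ 0

variable [Fintype M]

/-- The Gauss sum `γ(a) = ∑_{x ∈ M} e(a 𝒬(x))`. -/
def quadGaussSum (𝒬 : QuadraticMap ℤ M QModZ) (a : ℤ) : ℂ := ∑ x : M, e (a • 𝒬 x)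

/-- The operator `(f|ω(T))(x) = e(𝒬(x)) f(x)` on `ℂ^M`. -/
def weilT (𝒬 : QuadraticMap ℤ M QModZ) : Module.End ℂ (M → ℂ) where
  toFun f := fun x ↦ e (𝒬 x) * f x
  map_add' f g := by ext x; simp [mul_add]
  map_smul' c f := by ext x; simp [mul_left_comm]

/-- The operator `(f|ω(S))(x) = γ(1)⁻¹ ∑_{y ∈ M} e(-ℬ(x, y)) f(y)` on `ℂ^M`. -/
def weilS (𝒬 : QuadraticMap ℤ M QModZ) : Module.End ℂ (M → ℂ) where
  toFun f := fun x ↦ (quadGaussSum 𝒬 1)⁻¹ * ∑ y : M, e (-QuadraticMap.polar 𝒬 x y) * f y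
  map_add' f g := by ext x; simp [mul_add, Finset.sum_add_distrib]
  map_smul' c f := by
    ext x
    simp only [Pi.smul_apply, smul_eq_mul, RingHom.id_apply, Finset.mul_sum]
    exact Finset.sum_congr rfl fun y _ ↦ by ring

/-- The Weil representation of `(M, 𝒬)` is proper: the operators given for the generators `S`
and `T` are those of a true (not only projective) right-representation of `Γ = SL(2, ℤ)`
on `ℂ^M`.  A right-representation, `f|ω(AB) = (f|ω(A))|ω(B)`, is a representation of the
opposite group. -/
def IsProper (𝒬 : QuadraticMap ℤ M QModZ) : Prop :=
  ∃ ω : Representation ℂ SL(2, ℤ)ᵐᵒᵖ (M → ℂ),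
    ω (MulOpposite.op ModularGroup.S) = weilS 𝒬 ∧ ω (MulOpposite.op ModularGroup.T) = weilT 𝒬

/-- The Weil representation `ω_{(M, 𝒬)}`, when it is proper. -/
def weilRepresentation (𝒬 : QuadraticMap ℤ M QModZ) (h : IsProper 𝒬) :
    Representation ℂ SL(2, ℤ)ᵐᵒᵖ (M → ℂ) := h.choose

theorem weilRepresentation_S (𝒬 : QuadraticMap ℤ M QModZ) (h : IsProper 𝒬) :
    weilRepresentation 𝒬 h (MulOpposite.op ModularGroup.S) = weilS 𝒬 := h.choose_spec.1

theorem weilRepresentation_T (𝒬 : QuadraticMap ℤ M QModZ) (h : IsProper 𝒬) :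
    weilRepresentation 𝒬 h (MulOpposite.op ModularGroup.T) = weilT 𝒬 := h.choose_spec.2

/-- `weilRepresentation` is the only right-representation with the given operators. -/
theorem weilRepresentation_unique (𝒬 : QuadraticMap ℤ M QModZ) (h : IsProper 𝒬)
    (ω : Representation ℂ SL(2, ℤ)ᵐᵒᵖ (M → ℂ))
    (hS : ω (MulOpposite.op ModularGroup.S) = weilS 𝒬)
    (hT : ω (MulOpposite.op ModularGroup.T) = weilT 𝒬) :
    ω = weilRepresentation 𝒬 h := by
  have key : ∀ A : SL(2, ℤ),
      ω (MulOpposite.op A) = weilRepresentation 𝒬 h (MulOpposite.op A) := by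
    intro A
    have hA : A ∈ Subgroup.closure ({ModularGroup.S, ModularGroup.T} : Set SL(2, ℤ)) := by
      rw [SpecialLinearGroup.SL2Z_generators]; trivial
    induction hA using Subgroup.closure_induction with
    | mem x hx =>
      rcases hx with rfl | rfl
      · rw [hS, weilRepresentation_S]
      · rw [hT, weilRepresentation_T]
    | one => simp
    | mul x y _ _ hx hy => rw [MulOpposite.op_mul, map_mul, map_mul, hx, hy]
    | inv x _ hx =>
      have h1 : ω (MulOpposite.op x⁻¹) * ω (MulOpposite.op x) = 1 := by
        rw [← map_mul, ← MulOpposite.op_mul, mul_inv_cancel, MulOpposite.op_one, map_one]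
      have h2 : weilRepresentation 𝒬 h (MulOpposite.op x)
          * weilRepresentation 𝒬 h (MulOpposite.op x⁻¹) = 1 := by
        rw [← map_mul, ← MulOpposite.op_mul, inv_mul_cancel, MulOpposite.op_one, map_one]
      rw [hx] at h1
      exact left_inv_eq_right_inv h1 h2
  ext1 A
  exact key (MulOpposite.unop A)

/-- The proper Weil representation contains `ρ` (transposed) via the column vector `Φ` of functions `fⱼ`: they form
a basis of a `Γ`-invariant subspace of `ℂ^M` and `Φ|ω(A) = ρ(A) Φ` for all `A ∈ Γ`. -/
def ContainsVia (𝒬 : QuadraticMap ℤ M QModZ) (h : IsProper 𝒬) {n : ℕ}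
    (ρ : SL(2, ℤ) →* GL (Fin n) ℂ) (Φ : Fin n → M → ℂ) : Prop :=
  LinearIndependent ℂ Φ ∧
    ∀ (A : SL(2, ℤ)) (j : Fin n),
      weilRepresentation 𝒬 h (MulOpposite.op A) (Φ j)
        = ∑ k : Fin n, (ρ A : Matrix (Fin n) (Fin n) ℂ) j k • Φ k

end Weil

/-! ### Lattices, discriminant forms, lifts -/

/-- A complete lattice `L` in a rational vector space `V`, with a positive definite
quadratic form `Q` on `V` that takes integral values on `L`. -/
structure EvenLattice (V : Type*) [AddCommGroup V] [Module ℚ V] where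
  L : Submodule ℤ V
  Q : QuadraticForm ℚ V
  isLattice : Submodule.IsLattice ℚ L
  posDef : Q.PosDef
  integral : ∀ x ∈ L, ∃ m : ℤ, Q x = m

namespace EvenLattice

variable {V : Type*} [AddCommGroup V] [Module ℚ V] (Λ : EvenLattice V)

/-- The dual lattice `L^♯ = {y ∈ V | B(L, y) ⊆ ℤ}`, where `B(x, y) = Q(x + y) - Q(x) - Q(y)`. -/
def dual : Submodule ℤ V := LinearMap.BilinForm.dualSubmodule Λ.Q.polarBilin Λ.L

theorem mem_dual {y : V} :
    y ∈ Λ.dual ↔ ∀ x ∈ Λ.L, ∃ m : ℤ, QuadraticMap.polar Λ.Q x y = m := by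
  simp only [dual, LinearMap.BilinForm.mem_dualSubmodule, Submodule.mem_one,
    QuadraticMap.polarBilin_apply_apply]
  refine forall₂_congr fun x _ ↦ exists_congr fun m ↦ ?_
  rw [QuadraticMap.polar_comm, eq_comm]
  rfl

/-- The discriminant group `L^♯/L`. -/
abbrev Disc : Type _ := Λ.dual ⧸ Λ.L.submoduleOf Λ.dual

/-- The class `x + L` of `x ∈ L^♯`. -/
def cls (x : Λ.dual) : Λ.Disc := Submodule.Quotient.mk x

theorem intCast_eq_zero (m : ℤ) : (((m : ℤ) : ℚ) : QModZ) = 0 :=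
  (AddCircle.coe_eq_zero_iff (1 : ℚ)).mpr ⟨m, by simp⟩

/-- The function `x + L ↦ Q(x) + ℤ` on `L^♯/L`. -/
def discFun : Λ.Disc → QModZ :=
  Quotient.lift (fun x : Λ.dual ↦ ((Λ.Q (x : V) : ℚ) : QModZ)) (by
    intro a b hab
    have hL : ((a : V) - b) ∈ Λ.L := by
      have := (Submodule.quotientRel_def _).mp hab
      simpa [Submodule.submoduleOf] using this
    obtain ⟨m, hm⟩ := Λ.integral _ hL
    obtain ⟨k, hk⟩ := Λ.mem_dual.mp b.2 _ hL
    have h3 : Λ.Q (a : V) = Λ.Q (b : V) + ((m + k : ℤ) : ℚ) := by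
      have := hk
      rw [QuadraticMap.polar, sub_add_cancel, hm] at this
      push_cast
      linarith
    change ((Λ.Q (a : V) : ℚ) : QModZ) = ((Λ.Q (b : V) : ℚ) : QModZ)
    rw [h3, AddCircle.coe_add, intCast_eq_zero, add_zero])

theorem discFun_cls (x : Λ.dual) : Λ.discFun (Λ.cls x) = ((Λ.Q (x : V) : ℚ) : QModZ) := rfl

theorem polar_discFun_cls (x y : Λ.dual) : QuadraticMap.polar Λ.discFun (Λ.cls x) (Λ.cls y)
    = ((QuadraticMap.polar Λ.Q (x : V) (y : V) : ℚ) : QModZ) := by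
  have : Λ.cls x + Λ.cls y = Λ.cls (x + y) := rfl
  rw [QuadraticMap.polar, this, discFun_cls, discFun_cls, discFun_cls, QuadraticMap.polar,
    AddCircle.coe_sub, AddCircle.coe_sub]
  rfl

/-- The induced quadratic form `x + L ↦ Q(x) + ℤ` on `L^♯/L`. -/
def discForm : QuadraticMap ℤ Λ.Disc QModZ :=
  QuadraticMap.ofPolar Λ.discFun
    (by
      intro a x
      obtain ⟨x, rfl⟩ := Submodule.Quotient.mk_surjective _ x
      change Λ.discFun (Λ.cls (a • x)) = _ • Λ.discFun (Λ.cls x)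
      rw [discFun_cls, discFun_cls, ← AddCircle.coe_zsmul]
      congr 1
      rw [Submodule.coe_smul, ← Int.cast_smul_eq_zsmul ℚ a (x : V), QuadraticMap.map_smul]
      simp)
    (by
      intro x x' y
      obtain ⟨x, rfl⟩ := Submodule.Quotient.mk_surjective _ x
      obtain ⟨x', rfl⟩ := Submodule.Quotient.mk_surjective _ x'
      obtain ⟨y, rfl⟩ := Submodule.Quotient.mk_surjective _ y
      change QuadraticMap.polar Λ.discFun (Λ.cls (x + x')) (Λ.cls y)
        = QuadraticMap.polar Λ.discFun (Λ.cls x) (Λ.cls y)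
          + QuadraticMap.polar Λ.discFun (Λ.cls x') (Λ.cls y)
      rw [polar_discFun_cls, polar_discFun_cls, polar_discFun_cls, ← AddCircle.coe_add,
        Submodule.coe_add, QuadraticMap.polar_add_left])
    (by
      intro a x y
      obtain ⟨x, rfl⟩ := Submodule.Quotient.mk_surjective _ x
      obtain ⟨y, rfl⟩ := Submodule.Quotient.mk_surjective _ y
      change QuadraticMap.polar Λ.discFun (Λ.cls (a • x)) (Λ.cls y)
        = a • QuadraticMap.polar Λ.discFun (Λ.cls x) (Λ.cls y)
      rw [polar_discFun_cls, polar_discFun_cls, ← AddCircle.coe_zsmul]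
      congr 1
      rw [Submodule.coe_smul, ← Int.cast_smul_eq_zsmul ℚ a (x : V), QuadraticMap.polar_smul_left]
      simp)

theorem discForm_cls (x : Λ.dual) : Λ.discForm (Λ.cls x) = ((Λ.Q (x : V) : ℚ) : QModZ) := rfl

end EvenLattice

/-! ### Spherical polynomials -/

/-- `p : V → ℂ` is a homogeneous spherical polynomial of degree `ν` with respect to `Q`: in the
coordinates `ξ` of a basis `b` it is a complex homogeneous polynomial `P` of degree `ν` with
`∇ G⁻¹ ∇ᵗ P = 0`, where `G = (B(bⱼ, bₖ))` is the Gram matrix.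
The condition does not depend on the basis. -/
def IsSpherical {V : Type*} [AddCommGroup V] [Module ℚ V] (Q : QuadraticForm ℚ V) (ν : ℕ)
    (p : V → ℂ) : Prop :=
  ∃ (b : Module.Basis (Fin (Module.finrank ℚ V)) ℚ V)
    (P : MvPolynomial (Fin (Module.finrank ℚ V)) ℂ),
    P.IsHomogeneous ν ∧
    (∀ x : V, p x = MvPolynomial.eval (fun j ↦ ((b.repr x j : ℚ) : ℂ)) P) ∧
    ∑ j, ∑ k,
      (((Matrix.of fun i l ↦ QuadraticMap.polar Q (b i) (b l))⁻¹ j k : ℚ) : ℂ) •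
        MvPolynomial.pderiv j (MvPolynomial.pderiv k P) = 0

/-! ### Vector valued modular forms -/

/-- `(F|_k A)(τ) = (cτ + d)^{-k} F(Aτ)` for a vector valued function `F` on the upper half plane. -/
def slash {n : ℕ} (F : UpperHalfPlane → Fin n → ℂ) (k : ℤ) (A : SL(2, ℤ)) :
    UpperHalfPlane → Fin n → ℂ :=
  fun τ ↦ (((A 1 0 : ℤ) : ℂ) * (τ : ℂ) + ((A 1 1 : ℤ) : ℂ)) ^ (-k) • F (A • τ)

/-- `M_k(ρ)`: the holomorphic maps `F : ℍ → ℂⁿ` that satisfy `F|_k A = ρ(A) F` for all `A ∈ Γ` and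
are bounded in any region `Im τ ≥ r > 0`.  A map on the upper half plane is holomorphic if its
components are, as functions on the open set `{Im z > 0}` of `ℂ`. -/
def modularForms {n : ℕ} (ρ : SL(2, ℤ) →* GL (Fin n) ℂ) (k : ℤ) :
    Submodule ℂ (UpperHalfPlane → Fin n → ℂ) where
  carrier := {F |
    (∀ j, DifferentiableOn ℂ (fun z ↦ F (UpperHalfPlane.ofComplex z) j) {z | 0 < z.im}) ∧
    (∀ (A : SL(2, ℤ)) (τ : UpperHalfPlane),
      slash F k A τ = (ρ A : Matrix (Fin n) (Fin n) ℂ).mulVec (F τ)) ∧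
    (∀ r : ℝ, 0 < r → ∃ C : ℝ, ∀ τ : UpperHalfPlane, r ≤ τ.im → ‖F τ‖ ≤ C)}
  zero_mem' := by
    refine ⟨fun j ↦ ?_, fun A τ ↦ ?_, fun r _ ↦ ⟨0, fun τ _ ↦ ?_⟩⟩
    · exact differentiableOn_const (0 : ℂ)
    · simp [slash]
    · simp
  add_mem' := by
    rintro F G ⟨hF1, hF2, hF3⟩ ⟨hG1, hG2, hG3⟩
    refine ⟨fun j ↦ (hF1 j).add (hG1 j), fun A τ ↦ ?_, fun r hr ↦ ?_⟩
    · have h1 := hF2 A τ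
      have h2 := hG2 A τ
      simp only [slash] at h1 h2
      simp only [slash, Pi.add_apply, smul_add, Matrix.mulVec_add, h1, h2]
    · obtain ⟨C, hC⟩ := hF3 r hr
      obtain ⟨D, hD⟩ := hG3 r hr
      exact ⟨C + D, fun τ hτ ↦ (norm_add_le _ _).trans (add_le_add (hC τ hτ) (hD τ hτ))⟩
  smul_mem' := by
    rintro c F ⟨hF1, hF2, hF3⟩
    refine ⟨fun j ↦ (hF1 j).const_mul c, fun A τ ↦ ?_, fun r hr ↦ ?_⟩
    · have h1 := hF2 A τ
      simp only [slash] at h1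
      simp only [slash, Pi.smul_apply, Matrix.mulVec_smul, ← h1, smul_comm c]
    · obtain ⟨C, hC⟩ := hF3 r hr
      refine ⟨‖c‖ * C, fun τ hτ ↦ ?_⟩
      rw [Pi.smul_apply, norm_smul]
      exact mul_le_mul_of_nonneg_left (hC τ hτ) (norm_nonneg c)

/-! ### The theta series -/

section Theta

variable {V : Type*} [AddCommGroup V] [Module ℚ V] (Λ : EvenLattice V)
  {M : Type*} [AddCommGroup M] {𝒬 : QuadraticMap ℤ M QModZ}
  (π : Λ.discForm.IsometryEquiv 𝒬) {n : ℕ} (Φ : Fin n → M → ℂ) (p : V → ℂ)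

/-- The term `Φ(π(x)) p(x) q^{Q(x)} ∈ ℂⁿ` of the theta series, `q^{Q(x)} = exp(2πi Q(x) τ)`. -/
def thetaTerm (τ : UpperHalfPlane) (x : Λ.dual) : Fin n → ℂ :=
  fun j ↦ Φ j (π (Λ.cls x)) * p x *
    Complex.exp (2 * Real.pi * Complex.I * ((Λ.Q (x : V) : ℚ) : ℂ) * (τ : ℂ))

/-- `θ(τ) = ∑_{x ∈ L^♯} Φ(π(x)) p(x) q^{Q(x)}`. -/
def theta : UpperHalfPlane → Fin n → ℂ := fun τ ↦ ∑' x : Λ.dual, thetaTerm Λ π Φ p τ x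

end Theta

end ThetaRealization

end

/-!
The theta series of a spherical polynomial transforms under `T` by inspection and under `S` by
Poisson summation; since `S` and `T` generate `SL(2, ℤ)`, this is all that has to be checked.  It
suffices to treat the scalar series `θ_f = ∑ f(π(x)) p(x) q^{Q(x)}` for single functions `f` on `M`
(`scalarTheta`) and to prove `θ_f | A = θ_{f|ω(A)}` (`scalarTheta_slash`); the theorem is then
linear algebra in `f`.

For the inversion `S`, choose an orthogonal basis `eᵢ` of `V` inside `L`, with `dᵢ = B(eᵢ, eᵢ)`
(`EvenLattice.Frame`).  On cosets of `L' = ⨁ ℤ eᵢ` the series is a combination of products of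
one-dimensional sums of `x^k exp(-πbx²)`, to which the Poisson formula on `ℤ` applies
(`tsum_pow_mul_cexp`).  The Fourier transform turns the power `x^k` into a heat polynomial, that is,
into `exp(κ (d/dx)²) x^k` up to scaling; taken over all coordinates, a polynomial `P` becomes
`exp(s ∑ dᵢ⁻¹ ∂ᵢ²) P`.  Spherical polynomials are those annihilated by `∑ dᵢ⁻¹ ∂ᵢ²`, hence they are
fixed by this heat flow (`heatEval_smul_of_harmonic`), and only a factor `(-τ)^ν` from the
homogeneity remains (`tsum_harmonic_inversion`).  Summation over the cosets of `L'` in `L` replaces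
the dual of `L'` by `L^♯`, by orthogonality of characters (`exists_inversion_constant`).

This yields `θ_f | S = c θ_{f|ω(S)}` with a constant `c ≠ 0` that depends only on the lattice.  Its
value need not be computed: the relation `(ST)³ = S²`, which the operators of a proper Weil
representation satisfy, gives `c³ = c²` on a non-zero theta series (`scalarTheta_slash_S`).
-/

namespace ThetaRealization

/-! ### Heat polynomials -/

/-- The heat polynomial `exp(κ (d/dx)²) x^k`, defined by its three term recursion. -/
noncomputable def heatPoly (κ x : ℂ) : ℕ → ℂ
  | 0 => 1
  | 1 => x
  | k + 2 => x * heatPoly κ x (k + 1) + 2 * κ * (k + 1) * heatPoly κ x k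

theorem heatPoly_succ (κ x : ℂ) (k : ℕ) :
    heatPoly κ x (k + 1) = x * heatPoly κ x k + 2 * κ * k * heatPoly κ x (k - 1) := by
  rcases k with _ | k
  · simp [heatPoly]
  · simp [heatPoly]

theorem heatPoly_zero_left (x : ℂ) (k : ℕ) : heatPoly 0 x k = x ^ k := by
  induction k with
  | zero => simp [heatPoly]
  | succ k ih => rw [heatPoly_succ, ih]; ring

theorem hasDerivAt_heatPoly_right (κ x : ℂ) (k : ℕ) :
    HasDerivAt (fun x ↦ heatPoly κ x k) (k * heatPoly κ x (k - 1)) x := by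
  induction k using Nat.strong_induction_on with
  | _ k ih =>
    rcases k with _ | _ | k
    · simpa [heatPoly] using hasDerivAt_const x (1 : ℂ)
    · simpa [heatPoly] using hasDerivAt_id' x
    · have h := ((hasDerivAt_id x).mul (ih (k + 1) (by omega))).add
        ((ih k (by omega)).const_mul (2 * κ * (k + 1)))
      convert! h using 1
      simp only [Nat.add_sub_cancel, id, heatPoly_succ κ x k, Nat.cast_add, Nat.cast_one,
        show k + 2 - 1 = k + 1 from rfl]
      ring

/-- The heat equation: `d/dκ` acts as the second derivative in `x`. -/
theorem hasDerivAt_heatPoly_left (κ x : ℂ) (k : ℕ) :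
    HasDerivAt (fun κ ↦ heatPoly κ x k) (k * ((k - 1 : ℕ) * heatPoly κ x (k - 2))) κ := by
  induction k using Nat.strong_induction_on with
  | _ k ih =>
    rcases k with _ | _ | k
    · simpa [heatPoly] using hasDerivAt_const κ (1 : ℂ)
    · simpa [heatPoly] using hasDerivAt_const κ x
    · have h := ((ih (k + 1) (by omega)).const_mul x).add
        ((((hasDerivAt_id κ).const_mul 2).mul_const ((k : ℂ) + 1)).mul (ih k (by omega)))
      convert! h using 1
      simp only [Nat.add_sub_cancel, id, Nat.cast_add, Nat.cast_one,
        show k + 2 - 1 = k + 1 from rfl, show k + 1 - 2 = k - 1 by omega]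
      rcases k with _ | k
      · simp; norm_num
      · rw [show k + 1 + 2 - 2 = k + 1 from rfl, heatPoly_succ κ x k]
        simp only [Nat.add_sub_cancel, Nat.cast_add, Nat.cast_one, show k + 1 - 2 = k - 1 by omega]
        ring

/-! ### Poisson summation for polynomials times Gaussians in one variable -/

open Complex Filter Asymptotics MeasureTheory FourierTransform

theorem integrable_pow_mul_cexp_neg_mul_sq {b : ℂ} (hb : 0 < b.re) (k : ℕ) :
    Integrable fun x : ℝ ↦ (x : ℂ) ^ k * cexp (-Real.pi * b * (x : ℂ) ^ 2) := by
  have h := integrable_rpow_mul_exp_neg_mul_sq (b := Real.pi * b.re)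
    (mul_pos Real.pi_pos hb) (s := k) (by have : (0 : ℝ) ≤ k := k.cast_nonneg; linarith)
  refine h.mono (by fun_prop) (Eventually.of_forall fun x ↦ ?_)
  rw [norm_mul, norm_mul, norm_pow, Complex.norm_exp, Real.norm_eq_abs, Real.norm_eq_abs,
    Real.rpow_natCast, abs_pow, Real.abs_exp, Complex.norm_real, Real.norm_eq_abs]
  apply le_of_eq
  congr 2
  rw [show -(Real.pi : ℂ) * b * (x : ℂ) ^ 2 = ((-Real.pi * x ^ 2 : ℝ) : ℂ) * b by push_cast; ring,
    Complex.re_ofReal_mul]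
  ring

theorem isBigO_pow_mul_cexp_neg_mul_sq {b : ℂ} (hb : 0 < b.re) (k : ℕ) :
    (fun x : ℝ ↦ (x : ℂ) ^ k * cexp (-Real.pi * b * (x : ℂ) ^ 2))
      =O[cocompact ℝ] fun x : ℝ ↦ |x| ^ (-2 : ℝ) := by
  have hre : (-(Real.pi : ℂ) * b).re < 0 := by
    rw [← ofReal_neg, Complex.re_ofReal_mul]
    nlinarith [Real.pi_pos]
  have h1 := (cexp_neg_quadratic_isLittleO_abs_rpow_cocompact hre 0 (-2 - k)).isBigO
  have h2 : (fun x : ℝ ↦ (x : ℂ) ^ k) =O[cocompact ℝ] fun x : ℝ ↦ |x| ^ (k : ℝ) :=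
    IsBigO.of_bound 1 (Eventually.of_forall fun x ↦ by simp)
  refine ((h2.mul h1).congr' (Eventually.of_forall fun x ↦ by simp) ?_)
  have : ∀ᶠ x : ℝ in cocompact ℝ, x ≠ 0 :=
    (Filter.le_cofinite_iff_eventually_ne.mp (Filter.cocompact_le_cofinite)) 0
  filter_upwards [this] with x hx
  rw [← Real.rpow_add (abs_pos.mpr hx)]
  ring_nf

/-- The Fourier transform of `x^k exp(-πbx²)`.  Multiplication by `x` on the one side is
differentiation on the other, and this produces the recursion of the heat polynomials. -/
theorem fourier_pow_mul_cexp_neg_mul_sq {b : ℂ} (hb : 0 < b.re) (k : ℕ) :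
    𝓕 (fun x : ℝ ↦ (x : ℂ) ^ k * cexp (-Real.pi * b * (x : ℂ) ^ 2))
      = fun t : ℝ ↦ 1 / b ^ (1 / 2 : ℂ) *
        (heatPoly (1 / (4 * Real.pi * b)) (-I * t / b) k * cexp (-Real.pi / b * (t : ℂ) ^ 2)) := by
  have hb0 : b ≠ 0 := by rintro rfl; simp at hb
  have hpi : (Real.pi : ℂ) ≠ 0 := ofReal_ne_zero.mpr Real.pi_ne_zero
  induction k with
  | zero =>
    simp only [pow_zero, one_mul, heatPoly]
    exact fourier_gaussian_pi hb
  | succ k ih =>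
    ext t
    have h1 := Real.hasDerivAt_fourier (integrable_pow_mul_cexp_neg_mul_sq hb k)
      (by
        refine (integrable_pow_mul_cexp_neg_mul_sq hb (k + 1)).congr
          (Eventually.of_forall fun x ↦ ?_)
        simp only [Complex.real_smul]; ring) t
    rw [ih] at h1
    have hlin : HasDerivAt (fun t : ℝ ↦ -I * (t : ℂ) / b) (-I / b) t := by
      simpa using ((ofRealCLM.hasDerivAt (x := t)).const_mul (-I)).div_const b
    have hh := (hasDerivAt_heatPoly_right (1 / (4 * Real.pi * b)) (-I * t / b) k).comp t hlin
    have he : HasDerivAt (fun t : ℝ ↦ cexp (-Real.pi / b * (t : ℂ) ^ 2))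
        (cexp (-Real.pi / b * (t : ℂ) ^ 2) * (-Real.pi / b * (2 * t))) t := by
      have := (((ofRealCLM.hasDerivAt (x := t)).pow 2).const_mul (-Real.pi / b)).cexp
      simpa using this
    have h2 := (hh.mul he).const_mul (1 / b ^ (1 / 2 : ℂ))
    have h3 := h1.unique h2
    have h4 : 𝓕 (fun x : ℝ ↦ (-2 * Real.pi * I * (x : ℂ)) •
        ((x : ℂ) ^ k * cexp (-Real.pi * b * (x : ℂ) ^ 2))) t
        = (-2 * Real.pi * I) *
          𝓕 (fun x : ℝ ↦ (x : ℂ) ^ (k + 1) * cexp (-Real.pi * b * (x : ℂ) ^ 2)) t := by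
      rw [Real.fourier_eq, Real.fourier_eq, ← integral_const_mul]
      congr 1
      ext x
      simp only [Circle.smul_def, smul_eq_mul]
      ring
    rw [h4] at h3
    have h5 : (-2 * Real.pi * I : ℂ) ≠ 0 := by simp [hpi, I_ne_zero]
    apply mul_left_cancel₀ h5
    rw [h3, heatPoly_succ]
    simp only [Function.comp]
    field_simp
    ring_nf
    simp only [I_sq]
    ring

theorem re_inv_pos {b : ℂ} (hb : 0 < b.re) : 0 < (b⁻¹).re := by
  rw [Complex.inv_re]
  exact div_pos hb (Complex.normSq_pos.mpr (by rintro rfl; simp at hb))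

theorem summable_norm_pow_mul_cexp {b : ℂ} (hb : 0 < b.re) (k : ℕ) (y : ℝ) :
    Summable fun m : ℤ ↦
      ‖((m + y : ℝ) : ℂ) ^ k * cexp (-Real.pi * b * ((m + y : ℝ) : ℂ) ^ 2)‖ := by
  let f : C(ℝ, ℂ) := ⟨fun x : ℝ ↦ (x : ℂ) ^ k * cexp (-Real.pi * b * (x : ℂ) ^ 2), by fun_prop⟩
  have h := isBigO_norm_restrict_cocompact f (b := 2) two_pos
    (isBigO_pow_mul_cexp_neg_mul_sq hb k) ⟨{y}, isCompact_singleton⟩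
  have hs := summable_of_isBigO (Real.summable_abs_int_rpow one_lt_two)
    (h.comp_tendsto Int.tendsto_coe_cofinite)
  refine hs.of_nonneg_of_le (fun _ ↦ norm_nonneg _) fun m ↦ ?_
  have := ((f.comp (ContinuousMap.addRight (m : ℝ))).restrict {y}).norm_coe_le_norm ⟨y, rfl⟩
  simpa [f, add_comm] using this

theorem summable_norm_heatPoly_mul_cexp {b : ℂ} (hb : 0 < b.re) (κ c : ℂ) (k : ℕ) :
    Summable fun m : ℤ ↦ ‖heatPoly κ (c * m) k * cexp (-Real.pi * b * (m : ℂ) ^ 2)‖ := by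
  -- the extra power of `m` makes the recursion of the heat polynomials usable in the induction
  have key : ∀ l : ℕ, Summable fun m : ℤ ↦
      ‖(m : ℂ) ^ l * (heatPoly κ (c * m) k * cexp (-Real.pi * b * (m : ℂ) ^ 2))‖ := by
    induction k using Nat.strong_induction_on with
    | _ k ih =>
      intro l
      rcases k with _ | _ | k
      · simpa [heatPoly] using summable_norm_pow_mul_cexp hb l 0
      · have := (summable_norm_pow_mul_cexp hb (l + 1) 0).mul_left ‖c‖
        refine this.congr fun m ↦ ?_
        rw [← norm_mul]
        congr 1
        simp [heatPoly]
        ring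
      · have h := ((ih (k + 1) (by omega) (l + 1)).mul_left ‖c‖).add
          ((ih k (by omega) l).mul_left ‖2 * κ * (k + 1)‖)
        refine h.of_nonneg_of_le (fun _ ↦ norm_nonneg _) fun m ↦ ?_
        rw [← norm_mul, ← norm_mul]
        refine le_trans (le_of_eq ?_) (norm_add_le _ _)
        congr 1
        simp only [heatPoly]
        ring
  simpa using key 0

/-- **Poisson summation** for `x^k exp(-πbx²)` on a coset of `ℤ`. -/
theorem tsum_pow_mul_cexp {b : ℂ} (hb : 0 < b.re) (k : ℕ) (y : ℝ) :
    ∑' m : ℤ, ((m + y : ℝ) : ℂ) ^ k * cexp (-Real.pi * b * ((m + y : ℝ) : ℂ) ^ 2)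
      = ∑' m : ℤ, 1 / b ^ (1 / 2 : ℂ) *
        (heatPoly (1 / (4 * Real.pi * b)) (-I * m / b) k * cexp (-Real.pi / b * (m : ℂ) ^ 2))
          * cexp (2 * Real.pi * I * (m * y)) := by
  have h := Real.tsum_eq_tsum_fourier_of_rpow_decay_of_summable
    (f := fun x : ℝ ↦ (x : ℂ) ^ k * cexp (-Real.pi * b * (x : ℂ) ^ 2)) (by fun_prop) one_lt_two
    (isBigO_pow_mul_cexp_neg_mul_sq hb k)
    (by
      rw [fourier_pow_mul_cexp_neg_mul_sq hb]
      refine Summable.mul_left _ (Summable.of_norm ?_)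
      refine (summable_norm_heatPoly_mul_cexp (re_inv_pos hb) (1 / (4 * Real.pi * b))
        (-I / b) k).congr fun m ↦ ?_
      push_cast
      congr 3; ring_nf) y
  simp only [add_comm y] at h
  rw [h, fourier_pow_mul_cexp_neg_mul_sq hb]
  refine tsum_congr fun m ↦ ?_
  rw [fourier_coe_apply]
  push_cast
  congr 2
  ring

end ThetaRealization

namespace ThetaRealization
open Complex

/-! ### Sums of products over `ℤⁿ` -/

theorem summable_norm_prod_pi {n : ℕ} {f : Fin n → ℤ → ℂ}
    (hf : ∀ i, Summable fun m ↦ ‖f i m‖) :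
    Summable fun m : Fin n → ℤ ↦ ‖∏ i, f i (m i)‖ := by
  induction n with
  | zero => exact (hasSum_fintype _).summable
  | succ n ih =>
    rw [← (Fin.consEquiv fun _ : Fin (n + 1) ↦ ℤ).summable_iff]
    refine ((hf 0).mul_of_nonneg (ih fun i ↦ hf i.succ) (fun _ ↦ norm_nonneg _)
      fun _ ↦ norm_nonneg _).congr fun m ↦ ?_
    simp [Fin.prod_univ_succ, Fin.consEquiv]

theorem tsum_prod_pi {n : ℕ} {f : Fin n → ℤ → ℂ} (hf : ∀ i, Summable fun m ↦ ‖f i m‖) :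
    ∑' m : Fin n → ℤ, ∏ i, f i (m i) = ∏ i, ∑' m, f i m := by
  induction n with
  | zero => simp
  | succ n ih =>
    rw [← (Fin.consEquiv fun _ : Fin (n + 1) ↦ ℤ).tsum_eq, Fin.prod_univ_succ,
      ← ih fun i ↦ hf i.succ,
      tsum_mul_tsum_of_summable_norm (hf 0) (summable_norm_prod_pi fun i ↦ hf i.succ)]
    refine tsum_congr fun m ↦ ?_
    simp [Fin.prod_univ_succ, Fin.consEquiv]

/-! ### The heat operator on polynomials in several variables -/

section Heat

variable {σ : Type*} [Fintype σ]

/-- The value at `x` of `exp(∑ᵢ κᵢ ∂ᵢ²) P`, as a linear functional of the polynomial `P`; on a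
monomial it is a product of heat polynomials. -/
noncomputable def heatEval (κ x : σ → ℂ) : MvPolynomial σ ℂ →ₗ[ℂ] ℂ :=
  (MvPolynomial.basisMonomials σ ℂ).constr ℂ fun a ↦ ∏ i, heatPoly (κ i) (x i) (a i)

theorem heatEval_monomial (κ x : σ → ℂ) (a : σ →₀ ℕ) (c : ℂ) :
    heatEval κ x (MvPolynomial.monomial a c) = c * ∏ i, heatPoly (κ i) (x i) (a i) := by
  have : MvPolynomial.monomial a c = c • MvPolynomial.basisMonomials σ ℂ a := by
    rw [MvPolynomial.coe_basisMonomials, MvPolynomial.smul_monomial, smul_eq_mul, mul_one]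
  rw [this, map_smul, heatEval, Module.Basis.constr_basis, smul_eq_mul]

theorem heatEval_zero_left (x : σ → ℂ) (P : MvPolynomial σ ℂ) :
    heatEval 0 x P = MvPolynomial.eval x P := by
  induction P using MvPolynomial.induction_on' with
  | monomial a c =>
    rw [heatEval_monomial, MvPolynomial.eval_monomial, Finsupp.prod_fintype _ _ fun _ ↦ pow_zero _]
    simp [heatPoly_zero_left]
  | add p q hp hq => rw [map_add, map_add, hp, hq]

/-- The heat equation `d/ds exp(s ∑ᵢ wᵢ ∂ᵢ²) P = exp(s ∑ᵢ wᵢ ∂ᵢ²) (∑ᵢ wᵢ ∂ᵢ² P)`. -/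
theorem hasDerivAt_heatEval (w x : σ → ℂ) (P : MvPolynomial σ ℂ) (s : ℂ) :
    HasDerivAt (fun s : ℂ ↦ heatEval (s • w) x P)
      (heatEval (s • w) x (∑ i, w i • MvPolynomial.pderiv i (MvPolynomial.pderiv i P))) s := by
  classical
  induction P using MvPolynomial.induction_on' with
  | monomial a c =>
    simp only [heatEval_monomial, MvPolynomial.pderiv_monomial, map_sum, map_smul]
    have h (i : σ) : HasDerivAt (fun s : ℂ ↦ heatPoly ((s • w) i) (x i) (a i))
        (a i * ((a i - 1 : ℕ) * heatPoly ((s • w) i) (x i) (a i - 2)) * w i) s := by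
      have h1 : HasDerivAt (fun s : ℂ ↦ (s • w) i) (w i) s := by
        simpa using (hasDerivAt_id s).mul_const (w i)
      exact (hasDerivAt_heatPoly_left ((s • w) i) (x i) (a i)).comp s h1
    refine ((HasDerivAt.fun_finsetProd (u := Finset.univ) fun i _ ↦ h i).const_mul c).congr_deriv ?_
    rw [Finset.mul_sum]
    refine Finset.sum_congr rfl fun i _ ↦ ?_
    rw [← Finset.mul_prod_erase _ _ (Finset.mem_univ i)]
    have : ∏ j ∈ Finset.univ.erase i, heatPoly ((s • w) j) (x j)
          ((a - Finsupp.single i 1 - Finsupp.single i 1 : σ →₀ ℕ) j)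
        = ∏ j ∈ Finset.univ.erase i, heatPoly ((s • w) j) (x j) (a j) := by
      refine Finset.prod_congr rfl fun j hj ↦ ?_
      rw [Finsupp.tsub_apply, Finsupp.tsub_apply,
        Finsupp.single_eq_of_ne (Finset.ne_of_mem_erase hj)]
      rfl
    rw [this]
    simp only [Finsupp.tsub_apply, Finsupp.single_eq_same, smul_eq_mul]
    rw [show a i - 1 - 1 = a i - 2 from rfl]
    ring
  | add p q hp hq =>
    simp only [map_add, smul_add, Finset.sum_add_distrib] at hp hq ⊢
    exact hp.add hq

/-- A harmonic polynomial is stationary under the heat flow. -/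
theorem heatEval_smul_of_harmonic {w : σ → ℂ} {P : MvPolynomial σ ℂ}
    (hP : ∑ i, w i • MvPolynomial.pderiv i (MvPolynomial.pderiv i P) = 0) (s : ℂ) (x : σ → ℂ) :
    heatEval (s • w) x P = MvPolynomial.eval x P := by
  have h (s : ℂ) := hasDerivAt_heatEval w x P s
  simp only [hP, map_zero] at h
  have := is_const_of_deriv_eq_zero (fun s ↦ (h s).differentiableAt) (fun s ↦ (h s).deriv) s 0
  rw [this, zero_smul, heatEval_zero_left]

end Heat

theorem _root_.MvPolynomial.IsHomogeneous.eval_smul {σ R : Type*} [Finite σ] [CommSemiring R]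
    {P : MvPolynomial σ R} {ν : ℕ} (hP : P.IsHomogeneous ν) (c : R) (x : σ → R) :
    MvPolynomial.eval (c • x) P = c ^ ν * MvPolynomial.eval x P := by
  have := Fintype.ofFinite σ
  rw [MvPolynomial.eval_eq', MvPolynomial.eval_eq', Finset.mul_sum]
  refine Finset.sum_congr rfl fun a ha ↦ ?_
  have h : a.degree = ν :=
    (DFunLike.congr_fun Finsupp.degree_eq_weight_one a).trans
      (hP (MvPolynomial.mem_support_iff.mp ha))
  rw [Finsupp.degree_eq_sum] at h
  simp only [Pi.smul_apply, smul_eq_mul, mul_pow, Finset.prod_mul_distrib]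
  rw [Finset.prod_pow_eq_pow_sum, h]
  ring

/-! ### Poisson summation for polynomials times diagonal Gaussians -/

section Poisson

variable {n : ℕ} {b : Fin n → ℂ}

theorem summable_norm_eval_mul_cexp (hb : ∀ i, 0 < (b i).re) (P : MvPolynomial (Fin n) ℂ)
    (y : Fin n → ℝ) :
    Summable fun m : Fin n → ℤ ↦ ‖MvPolynomial.eval (fun i ↦ ((m i + y i : ℝ) : ℂ)) P *
      cexp (∑ i, -Real.pi * b i * ((m i + y i : ℝ) : ℂ) ^ 2)‖ := by
  induction P using MvPolynomial.induction_on' with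
  | monomial a c =>
    refine ((summable_norm_prod_pi fun i ↦
      summable_norm_pow_mul_cexp (hb i) (a i) (y i)).mul_left ‖c‖).congr fun m ↦ ?_
    rw [← norm_mul, MvPolynomial.eval_monomial, Finsupp.prod_fintype _ _ fun _ ↦ pow_zero _,
      Complex.exp_sum, Finset.prod_mul_distrib, mul_assoc]
  | add p q hp hq =>
    refine (hp.add hq).of_nonneg_of_le (fun _ ↦ norm_nonneg _) fun m ↦ ?_
    rw [map_add, add_mul]
    exact norm_add_le _ _

theorem summable_norm_heatEval_mul_cexp (hb : ∀ i, 0 < (b i).re) (P : MvPolynomial (Fin n) ℂ)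
    (κ c : Fin n → ℂ) :
    Summable fun m : Fin n → ℤ ↦ ‖heatEval κ (fun i ↦ c i * m i) P *
      cexp (∑ i, -Real.pi * b i * (m i : ℂ) ^ 2)‖ := by
  induction P using MvPolynomial.induction_on' with
  | monomial a u =>
    refine ((summable_norm_prod_pi fun i ↦
      summable_norm_heatPoly_mul_cexp (hb i) (κ i) (c i) (a i)).mul_left ‖u‖).congr fun m ↦ ?_
    rw [← norm_mul, heatEval_monomial, Complex.exp_sum, Finset.prod_mul_distrib, mul_assoc]
  | add p q hp hq =>
    refine (hp.add hq).of_nonneg_of_le (fun _ ↦ norm_nonneg _) fun m ↦ ?_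
    rw [map_add, add_mul]
    exact norm_add_le _ _

theorem norm_cexp_two_pi_I_mul (x : ℝ) : ‖cexp (2 * Real.pi * I * x)‖ = 1 := by
  rw [show 2 * (Real.pi : ℂ) * I * x = ((2 * Real.pi * x : ℝ) : ℂ) * I by push_cast; ring]
  exact norm_exp_ofReal_mul_I _

/-- The Fourier transform acts on polynomials times Gaussians through the heat operator. -/
theorem tsum_eval_mul_cexp (hb : ∀ i, 0 < (b i).re) (P : MvPolynomial (Fin n) ℂ)
    (y : Fin n → ℝ) :
    ∑' m : Fin n → ℤ, MvPolynomial.eval (fun i ↦ ((m i + y i : ℝ) : ℂ)) P *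
      cexp (∑ i, -Real.pi * b i * ((m i + y i : ℝ) : ℂ) ^ 2)
    = ∑' m : Fin n → ℤ, (∏ i, 1 / b i ^ (1 / 2 : ℂ)) *
      (heatEval (fun i ↦ 1 / (4 * Real.pi * b i)) (fun i ↦ -I / b i * m i) P *
        cexp (∑ i, -Real.pi * (b i)⁻¹ * (m i : ℂ) ^ 2)) *
        cexp (2 * Real.pi * I * ((∑ i, m i * y i : ℝ) : ℂ)) := by
  have hR (P : MvPolynomial (Fin n) ℂ) : Summable fun m : Fin n → ℤ ↦
      (∏ i, 1 / b i ^ (1 / 2 : ℂ)) *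
      (heatEval (fun i ↦ 1 / (4 * Real.pi * b i)) (fun i ↦ -I / b i * m i) P *
        cexp (∑ i, -Real.pi * (b i)⁻¹ * (m i : ℂ) ^ 2)) *
        cexp (2 * Real.pi * I * ((∑ i, m i * y i : ℝ) : ℂ)) := by
    apply Summable.of_norm
    refine ((summable_norm_heatEval_mul_cexp (fun i ↦ re_inv_pos (hb i)) P
      (fun i ↦ 1 / (4 * Real.pi * b i)) fun i ↦ -I / b i).mul_left
      ‖∏ i, 1 / b i ^ (1 / 2 : ℂ)‖).congr fun m ↦ ?_
    rw [← norm_mul, norm_mul _ (cexp (2 * _ * _ * _)), norm_cexp_two_pi_I_mul, mul_one]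
  induction P using MvPolynomial.induction_on' with
  | monomial a c =>
    have h1 := tsum_prod_pi fun i ↦ summable_norm_pow_mul_cexp (hb i) (a i) (y i)
    simp only [tsum_pow_mul_cexp (hb _)] at h1
    rw [← tsum_prod_pi] at h1
    · have h2 := congrArg (c * ·) h1
      simp only [← tsum_mul_left] at h2
      refine Eq.trans (tsum_congr fun m ↦ ?_) (h2.trans (tsum_congr fun m ↦ ?_))
      · rw [MvPolynomial.eval_monomial, Finsupp.prod_fintype _ _ fun _ ↦ pow_zero _,
          Complex.exp_sum, Finset.prod_mul_distrib, mul_assoc]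
      · rw [heatEval_monomial]
        simp only [Finset.prod_mul_distrib]
        rw [Complex.exp_sum, ofReal_sum, Finset.mul_sum, Complex.exp_sum]
        have e1 (i : Fin n) : -I * (m i : ℂ) / b i = -I / b i * m i := by ring
        have e2 (i : Fin n) : -(Real.pi : ℂ) / b i = -Real.pi * (b i)⁻¹ := by ring
        simp only [e1, e2, ofReal_mul, ofReal_intCast]
        ring
    · intro i
      have h3 := (summable_norm_heatPoly_mul_cexp (re_inv_pos (hb i)) (1 / (4 * Real.pi * b i))
        (-I / b i) (a i)).mul_left ‖1 / b i ^ (1 / 2 : ℂ)‖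
      refine h3.congr fun m ↦ ?_
      have := norm_cexp_two_pi_I_mul (m * y i)
      push_cast at this
      rw [norm_mul _ (cexp (2 * Real.pi * I * _)), this, mul_one, ← norm_mul]
      rw [show -I / b i * (m : ℂ) = -I * m / b i by ring,
        show -(Real.pi : ℂ) * (b i)⁻¹ = -Real.pi / b i by ring]
  | add p q hp hq =>
    simp only [map_add, add_mul, mul_add]
    rw [Summable.tsum_add (summable_norm_eval_mul_cexp hb p y).of_norm
      (summable_norm_eval_mul_cexp hb q y).of_norm, hp, hq, ← Summable.tsum_add (hR p) (hR q)]

/-- **Inversion formula** for theta series of a diagonal form `½ ∑ dᵢ xᵢ²` with coefficients in a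
homogeneous polynomial that is harmonic for this form. -/
theorem tsum_harmonic_inversion {d : Fin n → ℝ} (hd : ∀ i, 0 < d i) {ν : ℕ}
    {P : MvPolynomial (Fin n) ℂ} (hP : P.IsHomogeneous ν)
    (hharm : ∑ i, (d i : ℂ)⁻¹ • MvPolynomial.pderiv i (MvPolynomial.pderiv i P) = 0)
    {τ : ℂ} (hτ : 0 < τ.im) (y : Fin n → ℝ) :
    ∑' m : Fin n → ℤ, MvPolynomial.eval (fun i ↦ ((m i + y i : ℝ) : ℂ)) P *
      cexp (Real.pi * I * (-1 / τ) * ∑ i, d i * ((m i + y i : ℝ) : ℂ) ^ 2)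
    = ((∏ i, 1 / (I * d i / τ) ^ (1 / 2 : ℂ)) * (-τ) ^ ν) *
      ∑' m : Fin n → ℤ, MvPolynomial.eval (fun i ↦ ((m i / d i : ℝ) : ℂ)) P *
        cexp (Real.pi * I * τ * ∑ i, (m i : ℂ) ^ 2 / d i) *
        cexp (2 * Real.pi * I * ((∑ i, m i * y i : ℝ) : ℂ)) := by
  have hτ0 : τ ≠ 0 := by rintro rfl; simp at hτ
  have hd0 (i : Fin n) : (d i : ℂ) ≠ 0 := ofReal_ne_zero.mpr (hd i).ne'
  have hb (i : Fin n) : 0 < (I * d i / τ).re := by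
    have : I * d i / τ = (d i : ℂ) * (I / τ) := by ring
    rw [this, Complex.re_ofReal_mul]
    refine mul_pos (hd i) ?_
    rw [Complex.div_re]
    simp only [I_re, I_im, zero_mul, zero_div, one_mul, zero_add]
    exact div_pos hτ (Complex.normSq_pos.mpr hτ0)
  have h := tsum_eval_mul_cexp hb P y
  rw [← tsum_mul_left]
  refine Eq.trans (tsum_congr fun m ↦ ?_) (h.trans (tsum_congr fun m ↦ ?_))
  · congr 2
    rw [Finset.mul_sum]
    refine Finset.sum_congr rfl fun i _ ↦ ?_
    field_simp
  · -- the heat parameters are proportional to `dᵢ⁻¹`, so that `P` is stationary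
    have hκ : (fun i ↦ 1 / (4 * Real.pi * (I * d i / τ)))
        = (τ / (4 * Real.pi * I)) • fun i ↦ (d i : ℂ)⁻¹ := by
      ext i
      have := hd0 i
      simp only [Pi.smul_apply, smul_eq_mul]
      have hpi : (Real.pi : ℂ) ≠ 0 := ofReal_ne_zero.mpr Real.pi_ne_zero
      field_simp
    have hu : (fun i ↦ -I / (I * d i / τ) * (m i : ℂ))
        = (-τ) • fun i ↦ ((m i / d i : ℝ) : ℂ) := by
      ext i
      have := hd0 i
      simp only [Pi.smul_apply, smul_eq_mul]
      push_cast
      field_simp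
    have he : ∑ i, -(Real.pi : ℂ) * (I * d i / τ)⁻¹ * (m i : ℂ) ^ 2
        = Real.pi * I * τ * ∑ i, (m i : ℂ) ^ 2 / d i := by
      rw [Finset.mul_sum]
      refine Finset.sum_congr rfl fun i _ ↦ ?_
      have := hd0 i
      rw [inv_div]
      field_simp
      rw [I_sq]
      ring
    have hhom : MvPolynomial.eval ((-τ) • fun i ↦ ((m i / d i : ℝ) : ℂ)) P
        = (-τ) ^ ν * MvPolynomial.eval (fun i ↦ ((m i / d i : ℝ) : ℂ)) P := hP.eval_smul _ _
    rw [hκ, hu, heatEval_smul_of_harmonic hharm, he, hhom]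
    ring

end Poisson

end ThetaRealization

namespace ThetaRealization

/-! ### Linear substitutions and the Laplace operator -/

section Substitution

open MvPolynomial

variable {σ : Type*} [Fintype σ]

/-- The substitution `P(η) ↦ P(Aη)`. -/
noncomputable def linSubst (A : Matrix σ σ ℂ) : MvPolynomial σ ℂ →ₐ[ℂ] MvPolynomial σ ℂ :=
  aeval fun j ↦ ∑ i, C (A j i) * X i

theorem isHomogeneous_linSubst (A : Matrix σ σ ℂ) {P : MvPolynomial σ ℂ} {ν : ℕ}
    (hP : P.IsHomogeneous ν) : (linSubst A P).IsHomogeneous ν := by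
  have := hP.aeval (n := 1) (fun j ↦ ∑ i, C (A j i) * X i) fun j ↦
    IsHomogeneous.sum _ _ _ fun i _ ↦ isHomogeneous_C_mul_X _ _
  rwa [one_mul] at this

theorem eval_linSubst (A : Matrix σ σ ℂ) (P : MvPolynomial σ ℂ) (x : σ → ℂ) :
    eval x (linSubst A P) = eval (A.mulVec x) P := by
  induction P using MvPolynomial.induction_on with
  | C a => simp [linSubst]
  | add p q hp hq => simp [hp, hq]
  | mul_X p j hp => rw [map_mul, map_mul, hp, map_mul]; simp [linSubst, Matrix.mulVec, dotProduct]

/-- The chain rule for a linear substitution. -/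
theorem pderiv_linSubst [DecidableEq σ] (A : Matrix σ σ ℂ) (i : σ) (P : MvPolynomial σ ℂ) :
    pderiv i (linSubst A P) = ∑ j, A j i • linSubst A (pderiv j P) := by
  induction P using MvPolynomial.induction_on with
  | C a => simp [linSubst]
  | add p q hp hq => simp [hp, hq, Finset.sum_add_distrib]
  | mul_X p k hp =>
    have hX : pderiv i (linSubst A (X k)) = C (A k i) := by
      simp [linSubst, Pi.single_apply]
    simp only [map_mul, pderiv_mul, map_add, hp, hX, smul_add, Finset.sum_add_distrib, pderiv_X,
      Finset.sum_mul, smul_mul_assoc]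
    congr 1
    rw [Finset.sum_eq_single k (by
      intro j _ hj
      simp [Pi.single_eq_of_ne' hj]) (by simp)]
    simp [MvPolynomial.smul_eq_C_mul, mul_comm]

/-- The operator `∑ᵢ wᵢ ∂ᵢ²` in the variables `η` is the operator with symmetric matrix
`A diag(w) Aᵗ` in the variables `Aη`. -/
theorem sum_smul_pderiv_linSubst [DecidableEq σ] (A : Matrix σ σ ℂ) (w : σ → ℂ)
    (P : MvPolynomial σ ℂ) :
    ∑ i, w i • pderiv i (pderiv i (linSubst A P))
      = linSubst A (∑ j, ∑ k, (A * Matrix.diagonal w * A.transpose) j k •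
          pderiv j (pderiv k P)) := by
  have hM (j k : σ) : (A * Matrix.diagonal w * A.transpose) j k = ∑ i, A j i * w i * A k i := by
    rw [Matrix.mul_apply]
    simp only [Matrix.mul_diagonal, Matrix.transpose_apply]
  have hL (i : σ) : pderiv i (pderiv i (linSubst A P))
      = ∑ k, ∑ j, (A k i * A j i) • linSubst A (pderiv j (pderiv k P)) := by
    rw [pderiv_linSubst, map_sum]
    refine Finset.sum_congr rfl fun k _ ↦ ?_
    rw [Derivation.map_smul, pderiv_linSubst, Finset.smul_sum]
    exact Finset.sum_congr rfl fun j _ ↦ smul_smul _ _ _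
  simp only [hL, hM, map_sum, map_smul]
  simp only [Finset.smul_sum, Finset.sum_smul, smul_smul]
  rw [Finset.sum_comm]
  conv_rhs => rw [Finset.sum_comm]
  refine Finset.sum_congr rfl fun k _ ↦ ?_
  rw [Finset.sum_comm]
  refine Finset.sum_congr rfl fun j _ ↦ Finset.sum_congr rfl fun i _ ↦ ?_
  congr 1
  ring

end Substitution

/-! ### Orthogonal frames -/

namespace EvenLattice

variable {V : Type*} [AddCommGroup V] [Module ℚ V] (Λ : EvenLattice V)

/-- A basis of `V` that consists of pairwise orthogonal vectors of the lattice `L`, with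
`dᵢ = B(eᵢ, eᵢ)`. -/
structure Frame where
  e : Module.Basis (Fin (Module.finrank ℚ V)) ℚ V
  d : Fin (Module.finrank ℚ V) → ℤ
  mem : ∀ i, e i ∈ Λ.L
  d_pos : ∀ i, 0 < d i
  polar_eq : ∀ i j, QuadraticMap.polar Λ.Q (e i) (e j) = if i = j then (d i : ℚ) else 0

theorem exists_smul_mem (x : V) : ∃ N : ℕ, N ≠ 0 ∧ N • x ∈ Λ.L := by
  have hx : x ∈ Submodule.span ℚ (Λ.L : Set V) := by
    rw [Λ.isLattice.span_eq_top]; trivial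
  induction hx using Submodule.span_induction with
  | mem x h => exact ⟨1, one_ne_zero, by simpa using h⟩
  | zero => exact ⟨1, one_ne_zero, by simp⟩
  | add x y _ _ hx hy =>
    obtain ⟨N, hN, h1⟩ := hx
    obtain ⟨N', hN', h2⟩ := hy
    refine ⟨N * N', mul_ne_zero hN hN', ?_⟩
    rw [smul_add]
    refine add_mem ?_ ?_
    · rw [mul_comm, mul_smul]; exact nsmul_mem h1 _
    · rw [mul_smul]; exact nsmul_mem h2 _
  | smul q x _ hx =>
    obtain ⟨N, hN, h⟩ := hx
    refine ⟨N * q.den, mul_ne_zero hN q.den_nz, ?_⟩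
    have : (N * q.den) • q • x = q.num • N • x := by
      rw [← Nat.cast_smul_eq_nsmul ℚ, ← Nat.cast_smul_eq_nsmul ℚ, ← Int.cast_smul_eq_zsmul ℚ,
        smul_smul, smul_smul, ← Rat.mul_den_eq_num q]
      congr 1
      push_cast
      ring
    rw [this]
    exact zsmul_mem h _

theorem nonempty_frame [FiniteDimensional ℚ V] : Nonempty Λ.Frame := by
  have : Invertible (2 : ℚ) := invertibleOfNonzero two_ne_zero
  have hsymm : Λ.Q.polarBilin.IsSymm := ⟨fun x y ↦ QuadraticMap.polar_comm _ _ _⟩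
  obtain ⟨v, hv⟩ := LinearMap.BilinForm.exists_orthogonal_basis hsymm
  -- scale the orthogonal basis into `L`
  choose N hN hNL using fun i ↦ Λ.exists_smul_mem (v i)
  have hN' (i) : (N i : ℚ) ≠ 0 := Nat.cast_ne_zero.mpr (hN i)
  let e := v.unitsSMul fun i ↦ Units.mk0 (N i : ℚ) (hN' i)
  have he (i) : e i = (N i : ℚ) • v i := Module.Basis.unitsSMul_apply i
  have hmem (i) : e i ∈ Λ.L := by
    rw [he, Nat.cast_smul_eq_nsmul]; exact hNL i
  choose m hm using fun i ↦ Λ.integral _ (hmem i)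
  have hself (x : V) : QuadraticMap.polar Λ.Q x x = 2 * Λ.Q x := by
    rw [QuadraticMap.polar_self, two_nsmul, two_mul]
  refine ⟨⟨e, fun i ↦ 2 * m i, hmem, fun i ↦ ?_, fun i j ↦ ?_⟩⟩
  · have := Λ.posDef (e i) (e.ne_zero i)
    rw [hm] at this
    have : 0 < m i := by exact_mod_cast this
    omega
  · split_ifs with h
    · subst h
      rw [hself, hm]; push_cast; ring
    · have h0 : QuadraticMap.polar Λ.Q (v i) (v j) = 0 := hv h
      rw [he, he, QuadraticMap.polar_smul_left, QuadraticMap.polar_smul_right, h0]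
      simp

namespace Frame

variable {Λ} (F : Λ.Frame)

theorem polar_basis_right (x : V) (i) :
    QuadraticMap.polar Λ.Q x (F.e i) = F.d i * F.e.repr x i := by
  have : QuadraticMap.polar Λ.Q x (F.e i) = Λ.Q.polarBilin x (F.e i) := rfl
  rw [this]
  conv_lhs => rw [← F.e.sum_repr x]
  simp only [map_sum, map_smul, LinearMap.sum_apply, LinearMap.smul_apply,
    QuadraticMap.polarBilin_apply_apply, F.polar_eq, smul_eq_mul, mul_ite, mul_zero,
    Finset.sum_ite_eq', Finset.mem_univ, if_true]
  ring

theorem polar_eq_sum (x y : V) :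
    QuadraticMap.polar Λ.Q x y = ∑ i, F.d i * F.e.repr x i * F.e.repr y i := by
  have : QuadraticMap.polar Λ.Q x y = Λ.Q.polarBilin x y := rfl
  rw [this]
  conv_lhs => rw [← F.e.sum_repr y]
  simp only [map_sum, map_smul, QuadraticMap.polarBilin_apply_apply, F.polar_basis_right,
    smul_eq_mul]
  exact Finset.sum_congr rfl fun i _ ↦ by ring

theorem Q_eq_sum (x : V) : Λ.Q x = 1 / 2 * ∑ i, F.d i * F.e.repr x i ^ 2 := by
  have h : QuadraticMap.polar Λ.Q x x = 2 * Λ.Q x := by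
    rw [QuadraticMap.polar_self, two_nsmul, two_mul]
  rw [F.polar_eq_sum] at h
  have : ∑ i, F.d i * F.e.repr x i ^ 2 = ∑ i, F.d i * F.e.repr x i * F.e.repr x i :=
    Finset.sum_congr rfl fun i _ ↦ by ring
  rw [this, h]
  ring

/-- In the coordinates of an orthogonal frame a spherical polynomial is annihilated by
`∑ᵢ dᵢ⁻¹ ∂ᵢ²`. -/
theorem exists_harmonic {ν : ℕ} {p : V → ℂ} (hp : IsSpherical Λ.Q ν p) :
    ∃ P : MvPolynomial (Fin (Module.finrank ℚ V)) ℂ, P.IsHomogeneous ν ∧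
      (∀ x : V, p x = MvPolynomial.eval (fun j ↦ ((F.e.repr x j : ℚ) : ℂ)) P) ∧
      ∑ i, (F.d i : ℂ)⁻¹ • MvPolynomial.pderiv i (MvPolynomial.pderiv i P) = 0 := by
  obtain ⟨b, P, hP, hpP, hlap⟩ := hp
  let A : Matrix (Fin (Module.finrank ℚ V)) (Fin (Module.finrank ℚ V)) ℚ := b.toMatrix F.e
  let G : Matrix (Fin (Module.finrank ℚ V)) (Fin (Module.finrank ℚ V)) ℚ :=
    Matrix.of fun i l ↦ QuadraticMap.polar Λ.Q (b i) (b l)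
  let D : Matrix (Fin (Module.finrank ℚ V)) (Fin (Module.finrank ℚ V)) ℚ :=
    Matrix.diagonal fun i ↦ (F.d i : ℚ)
  have hd (i) : (F.d i : ℚ) ≠ 0 := Int.cast_ne_zero.mpr (F.d_pos i).ne'
  have hD : A.transpose * G * A = D := by
    have h := LinearMap.BilinForm.toMatrix_mul_basis_toMatrix b F.e Λ.Q.polarBilin
    have h1 : LinearMap.BilinForm.toMatrix b Λ.Q.polarBilin = G := by
      ext i j; simp [G, LinearMap.BilinForm.toMatrix_apply]
    have h2 : LinearMap.BilinForm.toMatrix F.e Λ.Q.polarBilin = D := by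
      ext i j
      simp [D, LinearMap.BilinForm.toMatrix_apply, F.polar_eq, Matrix.diagonal_apply]
    rwa [h1, h2] at h
  have hDinv : D * Matrix.diagonal (fun i ↦ (F.d i : ℚ)⁻¹) = 1 := by
    rw [Matrix.diagonal_mul_diagonal, ← Matrix.diagonal_one]
    congr 1
    ext i
    exact mul_inv_cancel₀ (hd i)
  have hAinv : A * F.e.toMatrix b = 1 := b.toMatrix_mul_toMatrix_flip F.e
  -- `AᵗGA = D` gives `G⁻¹ = A D⁻¹ Aᵗ`
  have hGinv : G⁻¹ = A * Matrix.diagonal (fun i ↦ (F.d i : ℚ)⁻¹) * A.transpose := by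
    apply Matrix.inv_eq_left_inv
    have h1 : A * Matrix.diagonal (fun i ↦ (F.d i : ℚ)⁻¹) * (A.transpose * G * A) = A := by
      rw [hD, mul_assoc, mul_eq_one_comm.mp hDinv, mul_one]
    calc A * Matrix.diagonal (fun i ↦ (F.d i : ℚ)⁻¹) * A.transpose * G
        = A * Matrix.diagonal (fun i ↦ (F.d i : ℚ)⁻¹) * A.transpose * G * (A * F.e.toMatrix b) := by
          rw [hAinv, mul_one]
      _ = A * Matrix.diagonal (fun i ↦ (F.d i : ℚ)⁻¹) * (A.transpose * G * A) * F.e.toMatrix b := by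
          simp only [mul_assoc]
      _ = 1 := by rw [h1, hAinv]
  let Ac : Matrix (Fin (Module.finrank ℚ V)) (Fin (Module.finrank ℚ V)) ℂ :=
    A.map (Rat.castHom ℂ)
  refine ⟨linSubst Ac P, isHomogeneous_linSubst _ hP, fun x ↦ ?_, ?_⟩
  · rw [hpP, eval_linSubst]
    congr 1
    congr 1
    ext j
    have h : b.repr x j = ∑ i, A j i * F.e.repr x i := by
      have := congrFun (Module.Basis.toMatrix_mulVec_repr F.e b x) j
      rw [← this]
      rfl
    rw [h]
    simp [Ac, Matrix.mulVec, dotProduct]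
  · rw [sum_smul_pderiv_linSubst]
    have h : Ac * Matrix.diagonal (fun i ↦ (F.d i : ℂ)⁻¹) * Ac.transpose
        = (G⁻¹).map (Rat.castHom ℂ) := by
      rw [hGinv, Matrix.map_mul, Matrix.map_mul, Matrix.transpose_map,
        Matrix.diagonal_map (map_zero _)]
      congr 3
      ext i
      simp
    rw [h]
    refine (congrArg (linSubst Ac) ?_).trans (map_zero _)
    exact hlap

end Frame

end EvenLattice

end ThetaRealization

namespace ThetaRealization
open Complex

/-! ### Characters and cosets -/

theorem e_zero : e 0 = 1 := by
  rw [← QuotientAddGroup.mk_zero]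
  change e ((0 : ℚ) : QModZ) = 1
  rw [e_coe]; simp

theorem e_add (x y : QModZ) : e (x + y) = e x * e y := by
  induction x using QuotientAddGroup.induction_on with | _ x =>
  induction y using QuotientAddGroup.induction_on with | _ y =>
  change e ((x + y : ℚ) : QModZ) = e (x : QModZ) * e (y : QModZ)
  rw [e_coe, e_coe, e_coe, ← Complex.exp_add]
  congr 1; push_cast; ring

theorem e_coe_eq_one_iff (x : ℚ) : e (x : QModZ) = 1 ↔ ∃ m : ℤ, x = m := by
  rw [e_coe, Complex.exp_eq_one_iff]
  refine exists_congr fun m ↦ ?_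
  have h : (2 * Real.pi * I : ℂ) ≠ 0 := by simp [Real.pi_ne_zero]
  rw [mul_comm, mul_left_inj' h]
  exact_mod_cast Iff.rfl

/-- A sum over a group, as a sum over the cosets of the kernel of a homomorphism. -/
theorem tsum_eq_sum_tsum_ker {G K : Type*} {H : Type*} [AddCommGroup G] [AddCommGroup H]
    [Fintype H] (f : G →+ H) {s : H → G} (hs : ∀ h, f (s h) = h) {i : K → G}
    (hi : Function.Injective i) (hker : ∀ g, f g = 0 ↔ ∃ k, i k = g) {φ : G → ℂ}
    (hφ : Summable φ) : ∑' g, φ g = ∑ h, ∑' k, φ (s h + i k) := by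
  have hi0 (k : K) : f (i k) = 0 := (hker _).mpr ⟨k, rfl⟩
  let E : H × K ≃ G := Equiv.ofBijective (fun x ↦ s x.1 + i x.2) ⟨by
    rintro ⟨h, k⟩ ⟨h', k'⟩ hh
    have h1 : h = h' := by simpa [hs, hi0] using congrArg f hh
    subst h1
    simpa [hi.eq_iff] using hh, fun g ↦ by
    obtain ⟨k, hk⟩ := (hker (g - s (f g))).mp (by simp [hs])
    exact ⟨(f g, k), by simp [hk]⟩⟩
  have h := (E.summable_iff.mpr hφ).tsum_prod
  rw [tsum_fintype (L := SummationFilter.unconditional H)] at h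
  rw [← E.tsum_eq]
  exact h

namespace EvenLattice

variable {V : Type*} [AddCommGroup V] [Module ℚ V] (Λ : EvenLattice V)

/-- The function `p(x) q^{Q(x)}` on `V`. -/
noncomputable def gaussTerm (p : V → ℂ) (τ : ℂ) (x : V) : ℂ :=
  p x * cexp (2 * Real.pi * I * ((Λ.Q x : ℚ) : ℂ) * τ)

theorem le_dual : Λ.L ≤ Λ.dual := by
  intro y hy
  rw [mem_dual]
  intro x hx
  obtain ⟨a, ha⟩ := Λ.integral _ (add_mem hx hy)
  obtain ⟨b, hb⟩ := Λ.integral _ hx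
  obtain ⟨c, hc⟩ := Λ.integral _ hy
  exact ⟨a - b - c, by rw [QuadraticMap.polar, ha, hb, hc]; push_cast; ring⟩

namespace Frame

variable {Λ} (F : Λ.Frame)

/-! ### The frame lattice and its dual -/

/-- The parametrization of the dual of `⨁ᵢ ℤ eᵢ` by `ℤⁿ`; the vectors `eᵢ / dᵢ` are the dual
basis. -/
noncomputable def dualVec (m : Fin (Module.finrank ℚ V) → ℤ) : V :=
  ∑ i, ((m i : ℚ) / F.d i) • F.e i

theorem d_ne_zero (i) : (F.d i : ℚ) ≠ 0 := Int.cast_ne_zero.mpr (F.d_pos i).ne'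

theorem repr_dualVec (m : Fin (Module.finrank ℚ V) → ℤ) (i) :
    F.e.repr (F.dualVec m) i = (m i : ℚ) / F.d i := by
  rw [dualVec, F.e.repr_sum_self]

theorem dualVec_injective : Function.Injective F.dualVec := by
  intro m m' h
  ext i
  have := congrArg (fun v ↦ F.e.repr v i) h
  simp only [repr_dualVec] at this
  have := (div_left_inj' (F.d_ne_zero i)).mp this
  exact_mod_cast this

theorem exists_dualVec {x : V} (hx : x ∈ Λ.dual) : ∃ m, F.dualVec m = x := by
  choose m hm using fun i ↦ Λ.mem_dual.mp hx (F.e i) (F.mem i)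
  refine ⟨m, F.e.repr.injective ?_⟩
  ext i
  rw [repr_dualVec, ← hm, QuadraticMap.polar_comm, F.polar_basis_right]
  have := F.d_ne_zero i
  field_simp

theorem polar_dualVec (m : Fin (Module.finrank ℚ V) → ℤ) (y : V) :
    QuadraticMap.polar Λ.Q (F.dualVec m) y = ∑ i, m i * F.e.repr y i := by
  rw [F.polar_eq_sum]
  refine Finset.sum_congr rfl fun i _ ↦ ?_
  rw [repr_dualVec]
  have := F.d_ne_zero i
  field_simp

/-- The inclusion of `⨁ᵢ ℤ eᵢ`, parametrized by `ℤⁿ`, into `L`. -/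
noncomputable def incl : (Fin (Module.finrank ℚ V) → ℤ) →ₗ[ℤ] Λ.L :=
  Fintype.linearCombination ℤ fun i ↦ (⟨F.e i, F.mem i⟩ : Λ.L)

theorem coe_incl (m : Fin (Module.finrank ℚ V) → ℤ) :
    (F.incl m : V) = ∑ i, (m i : ℚ) • F.e i := by
  rw [incl, Fintype.linearCombination_apply, AddSubmonoidClass.coe_finsetSum]
  refine Finset.sum_congr rfl fun i _ ↦ ?_
  rw [Int.cast_smul_eq_zsmul]
  rfl

theorem repr_incl (m : Fin (Module.finrank ℚ V) → ℤ) (i) :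
    F.e.repr (F.incl m : V) i = m i := by
  rw [coe_incl, F.e.repr_sum_self]

theorem incl_injective : Function.Injective F.incl := by
  intro m m' h
  ext i
  have := congrArg (fun v : Λ.L ↦ F.e.repr (v : V) i) h
  simp only [repr_incl] at this
  exact_mod_cast this

theorem finite_quotient : Finite (Λ.L ⧸ LinearMap.range F.incl) := by
  have : Module.Finite ℤ Λ.L := Module.Finite.of_fg Λ.isLattice.fg
  apply Module.finite_of_fg_torsion
  intro x
  obtain ⟨x, rfl⟩ := Submodule.Quotient.mk_surjective _ x
  have hprod : ∏ i, F.d i ≠ 0 := Finset.prod_ne_zero_iff.mpr fun i _ ↦ (F.d_pos i).ne'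
  refine ⟨⟨∏ i, F.d i, mem_nonZeroDivisors_of_ne_zero hprod⟩, ?_⟩
  choose m hm using fun i ↦ Λ.mem_dual.mp (Λ.le_dual x.2) (F.e i) (F.mem i)
  change (∏ i, F.d i) • Submodule.Quotient.mk x = (0 : Λ.L ⧸ LinearMap.range F.incl)
  rw [← Submodule.Quotient.mk_smul, Submodule.Quotient.mk_eq_zero]
  refine ⟨fun i ↦ (∏ j ∈ Finset.univ.erase i, F.d j) * m i, Subtype.ext (F.e.repr.injective ?_)⟩
  ext i
  rw [repr_incl, Submodule.coe_smul, ← Int.cast_smul_eq_zsmul ℚ, map_smul, Finsupp.smul_apply,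
    smul_eq_mul, Int.cast_mul, ← hm, QuadraticMap.polar_comm, F.polar_basis_right,
    ← Finset.mul_prod_erase _ _ (Finset.mem_univ i)]
  push_cast
  ring

theorem tsum_eq_sum_tsum_incl [Fintype (Λ.L ⧸ LinearMap.range F.incl)] {φ : Λ.L → ℂ}
    (hφ : Summable φ) : ∑' x, φ x =
      ∑ g : Λ.L ⧸ LinearMap.range F.incl, ∑' m, φ (Quotient.out g + F.incl m) := by
  let f : Λ.L →+ Λ.L ⧸ LinearMap.range F.incl := (LinearMap.range F.incl).mkQ.toAddMonoidHom
  have hs (g : Λ.L ⧸ LinearMap.range F.incl) : f (Quotient.out g) = g := Quotient.out_eq g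
  have hker (x : Λ.L) : f x = 0 ↔ ∃ m, F.incl m = x :=
    Submodule.Quotient.mk_eq_zero (LinearMap.range F.incl)
  exact tsum_eq_sum_tsum_ker f hs F.incl_injective hker hφ

open Classical in
/-- Orthogonality of characters of `L / ⨁ᵢ ℤ eᵢ`: this sum singles out `L^♯` inside the dual of
`⨁ᵢ ℤ eᵢ`. -/
theorem sum_cexp_polar_dualVec [Fintype (Λ.L ⧸ LinearMap.range F.incl)]
    (m : Fin (Module.finrank ℚ V) → ℤ) :
    ∑ g : Λ.L ⧸ LinearMap.range F.incl, cexp (2 * Real.pi * I *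
        ((QuadraticMap.polar Λ.Q (F.dualVec m) (Quotient.out g : Λ.L) : ℚ) : ℂ))
      = if F.dualVec m ∈ Λ.dual then (Fintype.card (Λ.L ⧸ LinearMap.range F.incl) : ℂ) else 0 := by
  let f : Λ.L →ₗ[ℤ] QModZ := AddMonoidHom.toIntLinearMap
    { toFun := fun l ↦ ((QuadraticMap.polar Λ.Q (F.dualVec m) (l : V) : ℚ) : QModZ)
      map_zero' := by simp
      map_add' := fun a b ↦ by
        rw [Submodule.coe_add, QuadraticMap.polar_add_right, AddCircle.coe_add] }
  have hf (l : Λ.L) : f l = ((QuadraticMap.polar Λ.Q (F.dualVec m) (l : V) : ℚ) : QModZ) := rfl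
  have hker : LinearMap.range F.incl ≤ LinearMap.ker f := by
    rintro _ ⟨k, rfl⟩
    rw [LinearMap.mem_ker, hf, F.polar_dualVec]
    simp only [repr_incl]
    have := intCast_eq_zero (∑ i, m i * k i)
    push_cast at this
    exact this
  let ψ : AddChar (Λ.L ⧸ LinearMap.range F.incl) ℂ :=
    { toFun := fun g ↦ ThetaRealization.e ((LinearMap.range F.incl).liftQ f hker g)
      map_zero_eq_one' := by rw [map_zero, e_zero]
      map_add_eq_mul' := fun a b ↦ by rw [map_add, e_add] }
  have hψ (l : Λ.L) : ψ (Submodule.Quotient.mk l)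
      = ThetaRealization.e ((QuadraticMap.polar Λ.Q (F.dualVec m) (l : V) : ℚ) : QModZ) := rfl
  have h1 (g : Λ.L ⧸ LinearMap.range F.incl) : cexp (2 * Real.pi * I *
      ((QuadraticMap.polar Λ.Q (F.dualVec m) (Quotient.out g : Λ.L) : ℚ) : ℂ)) = ψ g := by
    rw [← e_coe, ← hψ]
    congr 1
    exact Quotient.out_eq g
  simp only [h1]
  rw [AddChar.sum_eq_ite]
  have h2 : ψ = 0 ↔ F.dualVec m ∈ Λ.dual := by
    rw [mem_dual]
    constructor
    · intro h x hx
      have := hψ ⟨x, hx⟩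
      rw [h, AddChar.zero_apply] at this
      rw [QuadraticMap.polar_comm]
      exact (e_coe_eq_one_iff _).mp this.symm
    · intro h
      ext g
      obtain ⟨l, rfl⟩ := Submodule.Quotient.mk_surjective _ g
      rw [hψ, AddChar.zero_apply, e_coe_eq_one_iff, QuadraticMap.polar_comm]
      exact h l l.2
  simp only [h2]

/-! ### The inversion formula for an even lattice -/

theorem gaussTerm_eq {p : V → ℂ} {P : MvPolynomial (Fin (Module.finrank ℚ V)) ℂ}
    (hpP : ∀ x : V, p x = MvPolynomial.eval (fun j ↦ ((F.e.repr x j : ℚ) : ℂ)) P) (τ : ℂ) (x : V) :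
    Λ.gaussTerm p τ x = MvPolynomial.eval (fun j ↦ ((F.e.repr x j : ℚ) : ℂ)) P *
      cexp (Real.pi * I * τ * ∑ i, (F.d i : ℂ) * ((F.e.repr x i : ℚ) : ℂ) ^ 2) := by
  rw [gaussTerm, hpP, F.Q_eq_sum]
  congr 2
  push_cast
  ring

theorem summable_norm_gaussTerm_dualVec {ν : ℕ} {p : V → ℂ} (hp : IsSpherical Λ.Q ν p) {τ : ℂ}
    (hτ : 0 < τ.im) : Summable fun m ↦ ‖Λ.gaussTerm p τ (F.dualVec m)‖ := by
  obtain ⟨P, -, hpP, -⟩ := F.exists_harmonic hp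
  have hd (i) : (F.d i : ℂ) ≠ 0 := Int.cast_ne_zero.mpr (F.d_pos i).ne'
  have hb (i) : 0 < (-I * τ / F.d i).re := by
    have : -I * τ / F.d i = ((F.d i : ℝ)⁻¹ : ℝ) * (-I * τ) := by push_cast; ring
    rw [this, Complex.re_ofReal_mul]
    refine mul_pos (inv_pos.mpr (Int.cast_pos.mpr (F.d_pos i))) ?_
    simpa using hτ
  refine (summable_norm_heatEval_mul_cexp hb P 0 fun i ↦ (F.d i : ℂ)⁻¹).congr fun m ↦ ?_
  rw [heatEval_zero_left, F.gaussTerm_eq hpP]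
  simp only [repr_dualVec]
  congr 3
  · congr 1
    ext i
    push_cast
    ring
  · rw [Finset.mul_sum]
    refine Finset.sum_congr rfl fun i _ ↦ ?_
    have := hd i
    push_cast
    field_simp

theorem _root_.ThetaRealization.EvenLattice.summable_norm_gaussTerm [FiniteDimensional ℚ V]
    {ν : ℕ} {p : V → ℂ} (hp : IsSpherical Λ.Q ν p) {τ : ℂ}
    (hτ : 0 < τ.im) : Summable fun x : Λ.dual ↦ ‖Λ.gaussTerm p τ x‖ := by
  obtain ⟨F⟩ := Λ.nonempty_frame
  choose k hk using fun x : Λ.dual ↦ F.exists_dualVec x.2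
  have hinj : Function.Injective k := fun x y h ↦ Subtype.ext (by rw [← hk, ← hk, h])
  refine ((F.summable_norm_gaussTerm_dualVec hp hτ).comp_injective hinj).congr fun x ↦ ?_
  rw [Function.comp, hk]

/-- Inversion for a coset of the frame lattice. -/
theorem tsum_gaussTerm_incl_add {ν : ℕ} {p : V → ℂ} (hp : IsSpherical Λ.Q ν p) {τ : ℂ}
    (hτ : 0 < τ.im) (y : V) :
    ∑' m, Λ.gaussTerm p (-1 / τ) (y + (F.incl m : V))
      = ((∏ i, 1 / (I * (F.d i : ℝ) / τ) ^ (1 / 2 : ℂ)) * (-τ) ^ ν) *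
        ∑' m, Λ.gaussTerm p τ (F.dualVec m) *
          cexp (2 * Real.pi * I * ((QuadraticMap.polar Λ.Q (F.dualVec m) y : ℚ) : ℂ)) := by
  obtain ⟨P, hP, hpP, hharm⟩ := F.exists_harmonic hp
  have hd (i) : (F.d i : ℂ) ≠ 0 := Int.cast_ne_zero.mpr (F.d_pos i).ne'
  have h := tsum_harmonic_inversion (d := fun i ↦ (F.d i : ℝ))
    (fun i ↦ Int.cast_pos.mpr (F.d_pos i)) hP (by simpa using hharm) hτ
    (fun i ↦ ((F.e.repr y i : ℚ) : ℝ))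
  refine Eq.trans (tsum_congr fun m ↦ ?_) (h.trans (congrArg _ (tsum_congr fun m ↦ ?_)))
  · rw [F.gaussTerm_eq hpP]
    simp only [map_add, Finsupp.add_apply, repr_incl]
    push_cast
    simp only [add_comm]
  · rw [F.gaussTerm_eq hpP, F.polar_dualVec]
    simp only [repr_dualVec]
    push_cast
    congr 4
    refine Finset.sum_congr rfl fun i _ ↦ ?_
    have := hd i
    field_simp

/-- The product of the Gaussian factors.  The rank being even, it is an integral power of `τ`, and
no branch of the square root of `τ` enters. -/
theorem prod_cpow_half {r : ℕ} (hV : Module.finrank ℚ V = 2 * r) :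
    ∃ C : ℂ, C ≠ 0 ∧ ∀ τ : ℂ, 0 < τ.im →
      ∏ i, 1 / (I * (F.d i : ℝ) / τ) ^ (1 / 2 : ℂ) = C * τ ^ r := by
  have hd (i) : (0 : ℝ) < F.d i := Int.cast_pos.mpr (F.d_pos i)
  refine ⟨(∏ i, 1 / ((F.d i : ℝ) : ℂ) ^ (1 / 2 : ℂ)) * (1 / I) ^ r, ?_, fun τ hτ ↦ ?_⟩
  · refine mul_ne_zero (Finset.prod_ne_zero_iff.mpr fun i _ ↦ ?_) (pow_ne_zero _ (by simp))
    have : ((F.d i : ℝ) : ℂ) ≠ 0 := ofReal_ne_zero.mpr (hd i).ne'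
    simp [Complex.cpow_eq_zero_iff, (F.d_pos i).ne']
  · have hτ0 : τ ≠ 0 := by rintro rfl; simp at hτ
    have h1 (i) : 1 / (I * (F.d i : ℝ) / τ) ^ (1 / 2 : ℂ)
        = 1 / ((F.d i : ℝ) : ℂ) ^ (1 / 2 : ℂ) * (1 / (I / τ) ^ (1 / 2 : ℂ)) := by
      have hx : I / τ ≠ 0 := div_ne_zero I_ne_zero hτ0
      have hdi : ((F.d i : ℝ) : ℂ) ≠ 0 := ofReal_ne_zero.mpr (hd i).ne'
      have : I * (F.d i : ℝ) / τ = ((F.d i : ℝ) : ℂ) * (I / τ) := by ring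
      rw [this, Complex.cpow_def_of_ne_zero (mul_ne_zero hdi hx), Complex.log_ofReal_mul (hd i) hx,
        Complex.cpow_def_of_ne_zero hdi, Complex.cpow_def_of_ne_zero hx,
        Complex.ofReal_log (hd i).le, add_mul, Complex.exp_add]
      ring
    simp only [h1]
    have h2 : (1 / (I / τ) ^ (1 / 2 : ℂ)) ^ (2 * r) = (1 / I) ^ r * τ ^ r := by
      rw [pow_mul, div_pow, one_pow, ← Complex.cpow_nat_mul, ← mul_pow]
      push_cast
      rw [mul_one_div_cancel two_ne_zero, Complex.cpow_one]
      field_simp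
    rw [Finset.prod_mul_distrib, Finset.prod_const, Finset.card_univ, Fintype.card_fin, mul_assoc,
      ← h2, ← hV]

theorem _root_.ThetaRealization.EvenLattice.gaussTerm_neg {ν : ℕ} {p : V → ℂ}
    (hp : IsSpherical Λ.Q ν p) (τ : ℂ) (x : V) :
    Λ.gaussTerm p τ (-x) = (-1) ^ ν * Λ.gaussTerm p τ x := by
  obtain ⟨b, P, hP, hpP, -⟩ := hp
  rw [gaussTerm, gaussTerm, QuadraticMap.map_neg, hpP, hpP, ← mul_assoc, ← hP.eval_smul]
  congr 3
  ext i
  simp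

end Frame

/-- **Inversion formula** for theta series with spherical coefficients on the cosets of `L`.  The
constant depends neither on the coset nor on the spherical polynomial. -/
theorem exists_inversion_constant [FiniteDimensional ℚ V] {r : ℕ}
    (hV : Module.finrank ℚ V = 2 * r) :
    ∃ C : ℂ, C ≠ 0 ∧ ∀ (ν : ℕ) (p : V → ℂ), IsSpherical Λ.Q ν p → ∀ τ : ℂ, 0 < τ.im →
      ∀ y ∈ Λ.dual, ∑' x : Λ.L, Λ.gaussTerm p (-1 / τ) (y + (x : V))
        = C * τ ^ (r + ν) * ∑' x : Λ.dual, Λ.gaussTerm p τ x *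
          cexp (-(2 * Real.pi * I * ((QuadraticMap.polar Λ.Q (x : V) y : ℚ) : ℂ))) := by
  classical
  obtain ⟨F⟩ := Λ.nonempty_frame
  have hfin := F.finite_quotient
  have := Fintype.ofFinite (Λ.L ⧸ LinearMap.range F.incl)
  obtain ⟨C, hC, hCτ⟩ := F.prod_cpow_half hV
  refine ⟨C * Fintype.card (Λ.L ⧸ LinearMap.range F.incl),
    mul_ne_zero hC (Nat.cast_ne_zero.mpr Fintype.card_ne_zero), fun ν p hp τ hτ y hy ↦ ?_⟩
  have hτ' : 0 < (-1 / τ).im := by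
    have hτ0 : τ ≠ 0 := by rintro rfl; simp at hτ
    rw [neg_div, one_div, Complex.neg_im, Complex.inv_im, neg_div, neg_neg]
    exact div_pos hτ (Complex.normSq_pos.mpr hτ0)
  have hsumL : Summable fun x : Λ.L ↦ Λ.gaussTerm p (-1 / τ) (y + (x : V)) := by
    let t (x : Λ.L) : Λ.dual := ⟨y + x, add_mem hy (Λ.le_dual x.2)⟩
    have hinj : Function.Injective t :=
      fun a b h ↦ Subtype.ext (add_left_cancel (congrArg Subtype.val h))
    have h1 : Summable fun x : Λ.dual ↦ Λ.gaussTerm p (-1 / τ) x :=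
      (summable_norm_gaussTerm hp hτ').of_norm
    exact h1.comp_injective (i := t) hinj
  have hsumm (z : V) : Summable fun m ↦ Λ.gaussTerm p τ (F.dualVec m) *
      cexp (2 * Real.pi * I * ((QuadraticMap.polar Λ.Q (F.dualVec m) z : ℚ) : ℂ)) := by
    apply Summable.of_norm
    refine (F.summable_norm_gaussTerm_dualVec hp hτ).congr fun m ↦ ?_
    have := norm_cexp_two_pi_I_mul ((QuadraticMap.polar Λ.Q (F.dualVec m) z : ℚ) : ℝ)
    rw [Complex.ofReal_ratCast] at this
    rw [norm_mul, this, mul_one]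
  rw [F.tsum_eq_sum_tsum_incl hsumL]
  have hstep (g : Λ.L ⧸ LinearMap.range F.incl) :
      ∑' m, Λ.gaussTerm p (-1 / τ) (y + ((Quotient.out g + F.incl m : Λ.L) : V))
      = (C * τ ^ r * (-τ) ^ ν) * ∑' m, Λ.gaussTerm p τ (F.dualVec m) * cexp (2 * Real.pi * I *
          ((QuadraticMap.polar Λ.Q (F.dualVec m) (y + (Quotient.out g : Λ.L)) : ℚ) : ℂ)) := by
    rw [← hCτ τ hτ, ← F.tsum_gaussTerm_incl_add hp hτ]
    simp only [Submodule.coe_add, add_assoc]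
  simp only [hstep]
  rw [← Finset.mul_sum, ← Summable.tsum_finsetSum fun g _ ↦ hsumm _]
  -- the sum over the cosets is the indicator function of `L^♯`, times the index
  have hinner (m) : ∑ g : Λ.L ⧸ LinearMap.range F.incl, Λ.gaussTerm p τ (F.dualVec m) *
      cexp (2 * Real.pi * I *
        ((QuadraticMap.polar Λ.Q (F.dualVec m) (y + (Quotient.out g : Λ.L)) : ℚ) : ℂ))
      = (Fintype.card (Λ.L ⧸ LinearMap.range F.incl) : ℂ) * (Λ.dual : Set V).indicator
        (fun x ↦ Λ.gaussTerm p τ x * cexp (2 * Real.pi * I *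
          ((QuadraticMap.polar Λ.Q x y : ℚ) : ℂ))) (F.dualVec m) := by
    simp only [QuadraticMap.polar_add_right, Rat.cast_add, mul_add, Complex.exp_add]
    simp only [← mul_assoc (Λ.gaussTerm p τ (F.dualVec m))]
    rw [← Finset.mul_sum, F.sum_cexp_polar_dualVec, Set.indicator_apply]
    simp only [SetLike.mem_coe]
    split_ifs <;> ring
  simp only [hinner]
  rw [tsum_mul_left, F.dualVec_injective.tsum_eq (f := (Λ.dual : Set V).indicator _) (by
    intro x hx
    exact F.exists_dualVec (Set.mem_of_indicator_ne_zero hx)), ← tsum_subtype]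
  have h1 : ((-1 : ℂ) ^ ν) * (-1) ^ ν = 1 := by rw [← mul_pow]; simp
  -- reflect `x ↦ -x`; the sign `(-1)^ν` cancels the one in `(-τ)^ν`
  have hneg : ∑' x : (Λ.dual : Set V), Λ.gaussTerm p τ x * cexp (2 * Real.pi * I *
        ((QuadraticMap.polar Λ.Q (x : V) y : ℚ) : ℂ))
      = (-1) ^ ν * ∑' x : Λ.dual, Λ.gaussTerm p τ x *
          cexp (-(2 * Real.pi * I * ((QuadraticMap.polar Λ.Q (x : V) y : ℚ) : ℂ))) := by
    rw [← tsum_mul_left, ← (Equiv.neg Λ.dual).tsum_eq]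
    refine tsum_congr fun x ↦ ?_
    rw [Equiv.neg_apply, Submodule.coe_neg, gaussTerm_neg hp, QuadraticMap.polar_neg_left]
    rw [Rat.cast_neg, mul_neg, neg_neg, ← mul_assoc, ← mul_assoc, h1, one_mul]
  rw [hneg, neg_pow τ, pow_add]
  linear_combination (C * τ ^ r * τ ^ ν * Fintype.card (Λ.L ⧸ LinearMap.range F.incl) *
    ∑' x : Λ.dual, Λ.gaussTerm p τ x *
      cexp (-(2 * Real.pi * I * ((QuadraticMap.polar Λ.Q (x : V) y : ℚ) : ℂ)))) * h1

end EvenLattice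

end ThetaRealization

namespace ThetaRealization
open Complex
open scoped ModularForm

/-! ### Scalar valued theta series -/

theorem norm_apply_le_sum {M : Type*} [Fintype M] (f : M → ℂ) (y : M) : ‖f y‖ ≤ ∑ z, ‖f z‖ :=
  Finset.single_le_sum (f := fun z ↦ ‖f z‖) (fun _ _ ↦ norm_nonneg _) (Finset.mem_univ y)

section ScalarTheta

variable {V : Type*} [AddCommGroup V] [Module ℚ V] {Λ : EvenLattice V}
  {M : Type*} [AddCommGroup M] {𝒬 : QuadraticMap ℤ M QModZ}
  (π : Λ.discForm.IsometryEquiv 𝒬)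

/-- The theta series `∑_{x ∈ L^♯} f(π(x)) p(x) q^{Q(x)}` of a single function `f` on `M`. -/
noncomputable def scalarTheta (p : V → ℂ) (f : M → ℂ) : UpperHalfPlane → ℂ :=
  fun τ ↦ ∑' x : Λ.dual, f (π (Λ.cls x)) * Λ.gaussTerm p τ x

theorem form_cls (x : Λ.dual) : 𝒬 (π (Λ.cls x)) = ((Λ.Q (x : V) : ℚ) : QModZ) :=
  π.map_app (Λ.cls x)

theorem polar_form_cls (x y : Λ.dual) : QuadraticMap.polar 𝒬 (π (Λ.cls x)) (π (Λ.cls y))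
    = ((QuadraticMap.polar Λ.Q (x : V) (y : V) : ℚ) : QModZ) := by
  rw [← Λ.polar_discFun_cls, QuadraticMap.polar, ← map_add]
  simp only [π.map_app]
  rfl

theorem norm_gaussTerm_le (p : V → ℂ) {t : ℝ} {τ : ℂ} (h : t ≤ τ.im) (x : V) :
    ‖Λ.gaussTerm p τ x‖ ≤ ‖Λ.gaussTerm p (t * I) x‖ := by
  have hQ : 0 ≤ Λ.Q x := by
    rcases eq_or_ne x 0 with rfl | hx
    · rw [QuadraticMap.map_zero]
    · exact (Λ.posDef x hx).le
  have hre (z : ℂ) : (2 * Real.pi * I * ((Λ.Q x : ℚ) : ℂ) * z).re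
      = -(2 * Real.pi * (Λ.Q x : ℝ) * z.im) := by
    have : 2 * Real.pi * I * ((Λ.Q x : ℚ) : ℂ) * z
        = ((2 * Real.pi * (Λ.Q x : ℝ) : ℝ) : ℂ) * (I * z) := by push_cast; ring
    rw [this, Complex.re_ofReal_mul]
    simp
  rw [EvenLattice.gaussTerm, EvenLattice.gaussTerm, norm_mul, norm_mul, Complex.norm_exp,
    Complex.norm_exp, hre, hre]
  refine mul_le_mul_of_nonneg_left (Real.exp_le_exp.mpr (neg_le_neg ?_)) (norm_nonneg _)
  have : (t * I : ℂ).im = t := by simp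
  rw [this]
  have hQ' : (0 : ℝ) ≤ (Λ.Q x : ℝ) := by exact_mod_cast hQ
  exact mul_le_mul_of_nonneg_left h (mul_nonneg (by positivity) hQ')

theorem scalarTheta_slash_T [Fintype M] (p : V → ℂ) (k : ℤ) (f : M → ℂ) :
    scalarTheta π p f ∣[k] ModularGroup.T = scalarTheta π p (weilT 𝒬 f) := by
  ext τ
  rw [ModularForm.SL_slash_apply, ModularGroup.denom_apply, UpperHalfPlane.modular_T_smul]
  have h : ((ModularGroup.T 1 0 : ℤ) : ℂ) * τ + ((ModularGroup.T 1 1 : ℤ) : ℂ) = 1 := by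
    simp [ModularGroup.T]
  rw [h, one_zpow, mul_one]
  refine tsum_congr fun x ↦ ?_
  have hT : weilT 𝒬 f (π (Λ.cls x)) = e (𝒬 (π (Λ.cls x))) * f (π (Λ.cls x)) := rfl
  rw [hT, form_cls, e_coe, EvenLattice.gaussTerm, EvenLattice.gaussTerm,
    UpperHalfPlane.coe_vadd, mul_add, Complex.exp_add]
  push_cast
  rw [mul_one]
  ring

variable [FiniteDimensional ℚ V] {ν : ℕ} {p : V → ℂ}

theorem summable_norm_scalarTheta [Fintype M] (hp : IsSpherical Λ.Q ν p) (f : M → ℂ) {τ : ℂ}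
    (hτ : 0 < τ.im) :
    Summable fun x : Λ.dual ↦ ‖f (π (Λ.cls x)) * Λ.gaussTerm p τ x‖ := by
  refine ((EvenLattice.summable_norm_gaussTerm hp hτ).mul_left (∑ z, ‖f z‖)).of_nonneg_of_le
    (fun _ ↦ norm_nonneg _) fun x ↦ ?_
  rw [norm_mul]
  exact mul_le_mul_of_nonneg_right (norm_apply_le_sum f _) (norm_nonneg _)

theorem scalarTheta_sum [Fintype M] (hp : IsSpherical Λ.Q ν p) {ι : Type*} (s : Finset ι)
    (c : ι → ℂ) (f : ι → M → ℂ) :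
    scalarTheta π p (∑ k ∈ s, c k • f k) = ∑ k ∈ s, c k • scalarTheta π p (f k) := by
  ext τ
  simp only [scalarTheta, Finset.sum_apply, Pi.smul_apply, smul_eq_mul, Finset.sum_mul]
  rw [Summable.tsum_finsetSum]
  · refine Finset.sum_congr rfl fun k _ ↦ ?_
    rw [← tsum_mul_left]
    exact tsum_congr fun x ↦ mul_assoc _ _ _
  · intro k _
    refine ((summable_norm_scalarTheta π hp (f k) τ.2).of_norm.mul_left (c k)).congr fun x ↦ ?_
    exact (mul_assoc _ _ _).symm

theorem norm_scalarTheta_le [Fintype M] (hp : IsSpherical Λ.Q ν p) (f : M → ℂ) {t : ℝ}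
    (ht : 0 < t) {τ : UpperHalfPlane} (hτ : t ≤ τ.im) :
    ‖scalarTheta π p f τ‖ ≤ ∑' x : Λ.dual, (∑ z, ‖f z‖) * ‖Λ.gaussTerm p (t * I) x‖ := by
  have hs := (EvenLattice.summable_norm_gaussTerm hp (τ := t * I) (by simpa using ht)).mul_left
    (∑ z, ‖f z‖)
  refine tsum_of_norm_bounded hs.hasSum fun x ↦ ?_
  rw [norm_mul]
  exact mul_le_mul (norm_apply_le_sum f _) (norm_gaussTerm_le p hτ x) (norm_nonneg _)
    (Finset.sum_nonneg fun _ _ ↦ norm_nonneg _)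

theorem differentiableOn_scalarTheta [Fintype M] (hp : IsSpherical Λ.Q ν p) (f : M → ℂ) :
    DifferentiableOn ℂ (fun z ↦ scalarTheta π p f (UpperHalfPlane.ofComplex z)) {z | 0 < z.im} := by
  intro z hz
  -- on the half plane `Im w > Im z / 2` the terms are dominated by those at `i Im z / 2`
  have ht : 0 < z.im / 2 := half_pos hz
  have hU : IsOpen {w : ℂ | z.im / 2 < w.im} := isOpen_lt continuous_const Complex.continuous_im
  have hs := (EvenLattice.summable_norm_gaussTerm hp (τ := (z.im / 2 : ℝ) * I)
    (by rw [Complex.im_ofReal_mul]; simpa using hz)).mul_left (∑ y, ‖f y‖)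
  have hd := differentiableOn_tsum_of_summable_norm
    (F := fun (x : Λ.dual) w ↦ f (π (Λ.cls x)) * Λ.gaussTerm p w x) hs
    (fun x ↦ by unfold EvenLattice.gaussTerm; fun_prop) hU fun x w hw ↦ by
      rw [norm_mul]
      exact mul_le_mul (norm_apply_le_sum f _) (norm_gaussTerm_le p hw.le x)
        (norm_nonneg _) (Finset.sum_nonneg fun _ _ ↦ norm_nonneg _)
  have hzU : {w : ℂ | z.im / 2 < w.im} ∈ nhds z := hU.mem_nhds (half_lt_self (a := z.im) hz)
  refine ((hd.differentiableAt hzU).congr_of_eventuallyEq ?_).differentiableWithinAt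
  filter_upwards [hzU] with w hw
  have hw0 : 0 < w.im := ht.trans hw
  simp only [scalarTheta, UpperHalfPlane.ofComplex_apply_of_im_pos hw0]

/-! ### The action of `S` -/

/-- The action of `S` on scalar theta series, up to a constant that depends neither on the function
on `M` nor on the spherical polynomial. -/
theorem exists_scalarTheta_slash_S [Fintype M] {r : ℕ} (hV : Module.finrank ℚ V = 2 * r)
    (hγ : quadGaussSum 𝒬 1 ≠ 0) :
    ∃ c : ℂ, c ≠ 0 ∧ ∀ (ν : ℕ) (p : V → ℂ), IsSpherical Λ.Q ν p → ∀ f : M → ℂ,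
      scalarTheta π p f ∣[(r : ℤ) + ν] ModularGroup.S = c • scalarTheta π p (weilS 𝒬 f) := by
  obtain ⟨C, hC, hCinv⟩ := Λ.exists_inversion_constant hV
  refine ⟨C * quadGaussSum 𝒬 1, mul_ne_zero hC hγ, fun ν p hp f ↦ ?_⟩
  let φ : Λ.dual →+ M :=
    { toFun := fun x ↦ π (Λ.cls x)
      map_zero' := map_zero π
      map_add' := fun x y ↦ map_add π (Λ.cls x) (Λ.cls y) }
  have hsurj : Function.Surjective φ := fun y ↦ by
    obtain ⟨x, hx⟩ := Submodule.Quotient.mk_surjective _ (π.toLinearEquiv.symm y)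
    exact ⟨x, (congrArg π hx).trans (π.toLinearEquiv.apply_symm_apply y)⟩
  choose s hs using hsurj
  let i (x : Λ.L) : Λ.dual := ⟨x, Λ.le_dual x.2⟩
  have hi : Function.Injective i := fun a b h ↦ Subtype.ext (congrArg (fun x : Λ.dual ↦ (x : V)) h)
  have hker (x : Λ.dual) : φ x = 0 ↔ ∃ k, i k = x := by
    have h1 : φ x = 0 ↔ Λ.cls x = 0 := π.toLinearEquiv.map_eq_zero_iff
    rw [h1, EvenLattice.cls, Submodule.Quotient.mk_eq_zero]
    exact ⟨fun h ↦ ⟨⟨x, h⟩, rfl⟩, by rintro ⟨k, rfl⟩; exact k.2⟩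
  ext τ
  have hτ0 : (τ : ℂ) ≠ 0 := UpperHalfPlane.ne_zero τ
  have hτ' : 0 < (-1 / (τ : ℂ)).im := by
    have := UpperHalfPlane.im_inv_neg_coe_pos τ
    rwa [neg_div, one_div, ← inv_neg]
  have hsum : Summable fun x : Λ.dual ↦ f (φ x) * Λ.gaussTerm p (-1 / (τ : ℂ)) x :=
    (summable_norm_scalarTheta π hp f hτ').of_norm
  -- split `L^♯` into the cosets `π⁻¹(y) = s y + L`
  have hcoset : scalarTheta π p f (ModularGroup.S • τ) = ∑ y, ∑' x : Λ.L,
      f (φ (s y + i x)) * Λ.gaussTerm p (-1 / (τ : ℂ)) ((s y : V) + x) := by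
    refine Eq.trans ?_ (tsum_eq_sum_tsum_ker φ hs hi hker hsum)
    rw [UpperHalfPlane.modular_S_smul]
    have : (-(τ : ℂ))⁻¹ = -1 / (τ : ℂ) := by rw [inv_neg, neg_div, one_div]
    simp only [scalarTheta, this]
    rfl
  have hf (y : M) (x : Λ.L) : f (φ (s y + i x)) = f y := by
    rw [map_add, hs, (hker _).mpr ⟨x, rfl⟩, add_zero]
  simp only [hf, tsum_mul_left, hCinv ν p hp τ τ.2 _ (s _).2] at hcoset
  have he (x : Λ.dual) (y : M) :
      cexp (-(2 * Real.pi * I * ((QuadraticMap.polar Λ.Q (x : V) (s y : V) : ℚ) : ℂ)))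
        = e (-QuadraticMap.polar 𝒬 (π (Λ.cls x)) y) := by
    have hy : y = π (Λ.cls (s y)) := (hs y).symm
    conv_rhs => rw [hy, polar_form_cls, ← AddCircle.coe_neg, e_coe]
    push_cast
    rw [mul_neg]
  have hS (x : Λ.dual) : ∑ y, e (-QuadraticMap.polar 𝒬 (π (Λ.cls x)) y) * f y
      = quadGaussSum 𝒬 1 * weilS 𝒬 f (π (Λ.cls x)) := by
    change _ = _ * ((quadGaussSum 𝒬 1)⁻¹ * ∑ y, _)
    rw [mul_inv_cancel_left₀ hγ]
  rw [ModularForm.SL_slash_apply, ModularGroup.denom_S, hcoset]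
  have hterm (y : M) : Summable fun x : Λ.dual ↦
      f y * (Λ.gaussTerm p τ x * e (-QuadraticMap.polar 𝒬 (π (Λ.cls x)) y)) := by
    apply Summable.of_norm
    refine ((EvenLattice.summable_norm_gaussTerm hp τ.2).mul_left ‖f y‖).congr fun x ↦ ?_
    have := norm_cexp_two_pi_I_mul (-((QuadraticMap.polar Λ.Q (x : V) (s y : V) : ℚ) : ℝ))
    push_cast at this
    rw [mul_neg] at this
    rw [← he, norm_mul, norm_mul, this, mul_one]
  have hswap : ∑ y, f y * (C * (τ : ℂ) ^ (r + ν) * ∑' x : Λ.dual, Λ.gaussTerm p τ x *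
        cexp (-(2 * Real.pi * I * ((QuadraticMap.polar Λ.Q (x : V) (s y : V) : ℚ) : ℂ))))
      = C * (τ : ℂ) ^ (r + ν) * (quadGaussSum 𝒬 1 * scalarTheta π p (weilS 𝒬 f) τ) := by
    simp only [he, mul_left_comm (f _) (C * (τ : ℂ) ^ (r + ν))]
    rw [← Finset.mul_sum]
    have hmul (y : M) : f y * ∑' x : Λ.dual, Λ.gaussTerm p τ x *
          e (-QuadraticMap.polar 𝒬 (π (Λ.cls x)) y)
        = ∑' x : Λ.dual, f y * (Λ.gaussTerm p τ x *
          e (-QuadraticMap.polar 𝒬 (π (Λ.cls x)) y)) := tsum_mul_left.symm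
    simp only [hmul]
    rw [← Summable.tsum_finsetSum fun y _ ↦ hterm y, scalarTheta,
      ← tsum_mul_left (a := quadGaussSum 𝒬 1)]
    refine congrArg _ (tsum_congr fun x ↦ ?_)
    rw [← mul_assoc, ← hS, Finset.sum_mul]
    exact Finset.sum_congr rfl fun y _ ↦ by ring
  rw [hswap, Pi.smul_apply, smul_eq_mul, zpow_neg, ← Nat.cast_add, zpow_natCast]
  have := pow_ne_zero (r + ν) hτ0
  field_simp

/-! ### Equivariance under the modular group -/

theorem isSpherical_one : IsSpherical Λ.Q 0 fun _ ↦ 1 :=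
  ⟨Module.finBasis ℚ V, 1, MvPolynomial.isHomogeneous_one _ _, by simp, by simp⟩

theorem exists_scalarTheta_ne_zero [Fintype M] :
    ∃ f : M → ℂ, scalarTheta π (fun _ ↦ 1) f ≠ 0 := by
  -- at `τ = i` all terms of the theta series of `f = 1` are positive
  refine ⟨fun _ ↦ 1, fun h ↦ ?_⟩
  have h1 := congrFun h UpperHalfPlane.I
  have hterm (x : Λ.dual) : (1 : ℂ) * Λ.gaussTerm (fun _ ↦ 1) UpperHalfPlane.I (x : V)
      = ((Real.exp (-(2 * Real.pi * (Λ.Q (x : V) : ℝ))) : ℝ) : ℂ) := by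
    rw [one_mul, EvenLattice.gaussTerm, one_mul, UpperHalfPlane.coe_I, Complex.ofReal_exp]
    congr 1
    push_cast
    linear_combination (2 * Real.pi * ((Λ.Q (x : V) : ℚ) : ℂ)) * I_mul_I
  have hs := (summable_norm_scalarTheta π (isSpherical_one (Λ := Λ)) (fun _ ↦ 1)
    UpperHalfPlane.I.2).of_norm
  simp only [scalarTheta, Pi.zero_apply] at h1
  rw [tsum_congr hterm, ← Complex.ofReal_tsum, Complex.ofReal_eq_zero] at h1
  have hs' : Summable fun x : Λ.dual ↦ Real.exp (-(2 * Real.pi * (Λ.Q (x : V) : ℝ))) :=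
    Complex.summable_ofReal.mp (hs.congr hterm)
  exact (hs'.tsum_pos (fun _ ↦ (Real.exp_pos _).le) 0 (Real.exp_pos _)).ne' h1

theorem quadGaussSum_ne_zero_of_isProper [Fintype M] (h : IsProper 𝒬) : quadGaussSum 𝒬 1 ≠ 0 := by
  intro h0
  -- otherwise `weilS` would vanish, because `0⁻¹ = 0`
  have hS : weilS 𝒬 = 0 := by
    ext f x
    change (quadGaussSum 𝒬 1)⁻¹ * _ = 0
    rw [h0, inv_zero, zero_mul]
  have h1 : weilRepresentation 𝒬 h (MulOpposite.op ModularGroup.S)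
      * weilRepresentation 𝒬 h (MulOpposite.op ModularGroup.S⁻¹) = 1 := by
    rw [← map_mul, ← MulOpposite.op_mul, inv_mul_cancel, MulOpposite.op_one, map_one]
  rw [weilRepresentation_S, hS, zero_mul] at h1
  exact zero_ne_one h1

/-- The Gauss sum is the inverse of the constant of the inversion formula.  Indeed
`(ST)³ = S²` holds in `SL(2, ℤ)` and, the Weil representation being proper, also for its
operators; comparison of the two sides on a non-zero theta series gives `c³ = c²`. -/
theorem scalarTheta_slash_S [Fintype M] (h : IsProper 𝒬) {r : ℕ}
    (hV : Module.finrank ℚ V = 2 * r) (hp : IsSpherical Λ.Q ν p) (f : M → ℂ) :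
    scalarTheta π p f ∣[(r : ℤ) + ν] ModularGroup.S = scalarTheta π p (weilS 𝒬 f) := by
  obtain ⟨c, hc, hcS⟩ := exists_scalarTheta_slash_S π hV (quadGaussSum_ne_zero_of_isProper h)
  suffices c = 1 by rw [hcS ν p hp f, this, one_smul]
  have h1 := isSpherical_one (Λ := Λ)
  have hS (f : M → ℂ) := hcS 0 _ h1 f
  have hT (f : M → ℂ) := scalarTheta_slash_T π (fun _ ↦ 1) ((r : ℤ) + (0 : ℕ)) f
  have hrel : ModularGroup.S * ModularGroup.T * ModularGroup.S * ModularGroup.T * ModularGroup.S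
      * ModularGroup.T = ModularGroup.S * ModularGroup.S := by decide
  obtain ⟨g, hg⟩ := exists_scalarTheta_ne_zero π
  let ω := weilRepresentation 𝒬 h
  have hω : ω (MulOpposite.op (ModularGroup.S * ModularGroup.S))
      = weilS 𝒬 * weilS 𝒬 := by
    rw [MulOpposite.op_mul, map_mul, weilRepresentation_S]
  have hω' : ω (MulOpposite.op (ModularGroup.S * ModularGroup.S))
      = weilT 𝒬 * weilS 𝒬 * weilT 𝒬 * weilS 𝒬 * weilT 𝒬 * weilS 𝒬 := by
    rw [← hrel]
    simp only [MulOpposite.op_mul, map_mul, ω, weilRepresentation_S, weilRepresentation_T,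
      mul_assoc]
  -- the preimage of `g` under `ω(S²)`
  let f' := ω (MulOpposite.op (ModularGroup.S * ModularGroup.S)⁻¹) g
  have hf' : ω (MulOpposite.op (ModularGroup.S * ModularGroup.S)) f' = g := by
    rw [← Module.End.mul_apply, ← map_mul, ← MulOpposite.op_mul, inv_mul_cancel,
      MulOpposite.op_one, map_one, Module.End.one_apply]
  have e2 : scalarTheta π (fun _ ↦ 1) f' ∣[(r : ℤ) + (0 : ℕ)]
      (ModularGroup.S * ModularGroup.S) = c ^ 2 • scalarTheta π (fun _ ↦ 1) g := by
    rw [SlashAction.slash_mul, hS, ModularForm.SL_smul_slash, hS, smul_smul, ← pow_two]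
    congr 2
    rw [← hf', hω, Module.End.mul_apply]
  have e3 : scalarTheta π (fun _ ↦ 1) f' ∣[(r : ℤ) + (0 : ℕ)]
      (ModularGroup.S * ModularGroup.S) = c ^ 3 • scalarTheta π (fun _ ↦ 1) g := by
    rw [← hrel]
    simp only [SlashAction.slash_mul, hS, hT, ModularForm.SL_smul_slash, smul_smul]
    congr 1
    · ring
    · rw [← hf', hω']
      simp only [Module.End.mul_apply]
  have h32 : c ^ 3 = c ^ 2 := smul_left_injective ℂ hg (e3.symm.trans e2)
  exact mul_left_cancel₀ (pow_ne_zero 2 hc) (by rw [mul_one, ← pow_succ, h32])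

theorem scalarTheta_slash [Fintype M] (h : IsProper 𝒬) {r : ℕ}
    (hV : Module.finrank ℚ V = 2 * r) (hp : IsSpherical Λ.Q ν p) (A : SL(2, ℤ)) (f : M → ℂ) :
    scalarTheta π p f ∣[(r : ℤ) + ν] A
      = scalarTheta π p (weilRepresentation 𝒬 h (MulOpposite.op A) f) := by
  have hA : A ∈ Subgroup.closure ({ModularGroup.S, ModularGroup.T} : Set SL(2, ℤ)) := by
    rw [SpecialLinearGroup.SL2Z_generators]; trivial
  induction hA using Subgroup.closure_induction generalizing f with
  | mem x hx =>
    rcases hx with rfl | rfl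
    · rw [weilRepresentation_S, scalarTheta_slash_S π h hV hp]
    · rw [weilRepresentation_T, scalarTheta_slash_T]
  | one => rw [SlashAction.slash_one, MulOpposite.op_one, map_one, Module.End.one_apply]
  | mul x y _ _ hx hy =>
    rw [SlashAction.slash_mul, hx, hy, MulOpposite.op_mul, map_mul, Module.End.mul_apply]
  | inv x _ hx =>
    have h1 := hx (weilRepresentation 𝒬 h (MulOpposite.op x⁻¹) f)
    rw [← Module.End.mul_apply, ← map_mul, ← MulOpposite.op_mul, inv_mul_cancel,
      MulOpposite.op_one, map_one, Module.End.one_apply] at h1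
    rw [← h1, ← SlashAction.slash_mul, mul_inv_cancel, SlashAction.slash_one]

end ScalarTheta

end ThetaRealization

theorem mainTheorem4
    {M : Type*} [AddCommGroup M] [Fintype M]
    (𝒬 : QuadraticMap ℤ M ThetaRealization.QModZ)
    (h𝒬 : ThetaRealization.IsNondegenerate 𝒬)
    (hproper : ThetaRealization.IsProper 𝒬)
    {n : ℕ} (ρ : SL(2, ℤ) →* GL (Fin n) ℂ) (Φ : Fin n → M → ℂ)
    (hΦ : ThetaRealization.ContainsVia 𝒬 hproper ρ Φ)
    {V : Type*} [AddCommGroup V] [Module ℚ V] [FiniteDimensional ℚ V]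
    (r : ℕ) (hV : Module.finrank ℚ V = 2 * r)
    (Λ : ThetaRealization.EvenLattice V)
    (π : Λ.discForm.IsometryEquiv 𝒬)
    (ν : ℕ) (p : V → ℂ) (hp : ThetaRealization.IsSpherical Λ.Q ν p) :
    (∀ τ : UpperHalfPlane, Summable (ThetaRealization.thetaTerm Λ π Φ p τ)) ∧
      ThetaRealization.theta Λ π Φ p ∈ ThetaRealization.modularForms ρ ((r : ℤ) + ν) := by
  have hterm (τ : UpperHalfPlane) (x : Λ.dual) (j : Fin n) :
      ThetaRealization.thetaTerm Λ π Φ p τ x j = Φ j (π (Λ.cls x)) * Λ.gaussTerm p τ x :=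
    mul_assoc _ _ _
  have hsum (τ : UpperHalfPlane) : Summable (ThetaRealization.thetaTerm Λ π Φ p τ) := by
    rw [Pi.summable]
    intro j
    simp only [hterm]
    exact (ThetaRealization.summable_norm_scalarTheta π hp (Φ j) τ.2).of_norm
  have htheta (τ : UpperHalfPlane) (j : Fin n) :
      ThetaRealization.theta Λ π Φ p τ j = ThetaRealization.scalarTheta π p (Φ j) τ := by
    rw [ThetaRealization.theta, tsum_apply (hsum τ)]
    exact tsum_congr fun x ↦ hterm τ x j
  refine ⟨hsum, fun j ↦ ?_, fun A τ ↦ ?_, fun t ht ↦ ?_⟩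
  · simp only [htheta]
    exact ThetaRealization.differentiableOn_scalarTheta π hp (Φ j)
  · ext j
    have h := congrFun (ThetaRealization.scalarTheta_slash π hproper hV hp A (Φ j)) τ
    rw [hΦ.2 A j, ThetaRealization.scalarTheta_sum π hp, ModularForm.SL_slash_apply,
      ModularGroup.denom_apply, mul_comm] at h
    simp only [ThetaRealization.slash, Pi.smul_apply, smul_eq_mul, htheta, Matrix.mulVec,
      dotProduct]
    rw [h]
    simp
  · refine ⟨∑ j, ∑' x : Λ.dual, (∑ z, ‖Φ j z‖) * ‖Λ.gaussTerm p (t * Complex.I) x‖,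
      fun τ hτ ↦ ?_⟩
    have hnn (j : Fin n) :
        0 ≤ ∑' x : Λ.dual, (∑ z, ‖Φ j z‖) * ‖Λ.gaussTerm p (t * Complex.I) x‖ :=
      tsum_nonneg fun x ↦ mul_nonneg (Finset.sum_nonneg fun _ _ ↦ norm_nonneg _) (norm_nonneg _)
    rw [pi_norm_le_iff_of_nonneg (Finset.sum_nonneg fun j _ ↦ hnn j)]
    intro j
    rw [htheta]
    exact (ThetaRealization.norm_scalarTheta_le π hp (Φ j) ht hτ).trans
      (Finset.single_le_sum (fun j _ ↦ hnn j) (Finset.mem_univ j))
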